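/- **Notation.** Let $n\in\mathbb N$ and let $D\subset\mathbb C^n$ be open and invariant under conjugation $z\mapsto\overline z^h$ of each single coordinate $z_h$. Write $z_h=\alpha_h+i\beta_h$. Let $e_K$, $K\subseteq\{1,\dots,n\}$, be the standard basis of $\mathbb R^{2^n}$. A *stem function* on $D$ is a function $F=\sum_K e_KF_K:D\to\mathbb H\otimes\mathbb R^{2^n}$, $F_K:D\to\mathbb H$, with $F_K(\overline z^h)=(-1)^{|K\cap\{h\}|}F_K(z)$ for all $K$, $h$. Let $\mathbb S=\{J\in\mathbb H: J^2=-1\}$ and $$\Omega_D=\{(\alpha_1+J_1\beta_1,\dots,\alpha_n+J_n\beta_n): (\alpha_1+i\beta_1,\dots,\alpha_n+i\beta_n)\in D,\ J_1,\dots,J_n\in\mathbb S\}\subset\mathbb H^n .$$ The *slice function* $f=\mathcal I(F):\Omega_D\to\mathbb H$ induced by $F$ is $$f(\alpha_1+J_1\beta_1,\dots,\alpha_n+J_n\beta_n)=\sum_K J_KF_K(z),\qquad J_K=J_{k_1}\cdots J_{k_p}\ \text{ for } K=\{k_1<\dots<k_p\}$$ ($F$ is uniquely determined by $f$). It is *slice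 regular* if $F$ is $C^1$ and $\partial F/\partial\alpha_h+\mathcal J_h\,\partial F/\partial\beta_h=0$ for every $h$, where $\mathcal J_h(q\otimes e_K)=(-1)^{|K\cap\{h\}|}q\otimes e_{K\Delta\{h\}}$. Stem functions are multiplied by $(F\otimes G)(z)=\sum_{H,K}(-1)^{|H\cap K|}e_{K\Delta H}F_K(z)G_H(z)$. Put $Z_j=\alpha_j+e_{\{j\}}\beta_j$ and $Z_K=Z_{k_1}\otimes\cdots\otimes Z_{k_p}$ ($Z_\emptyset=1$). Put $F'_h=\sum_{K\not\ni h}e_K\,\beta_h^{-1}F_{K\cup\{h\}}$ where $\beta_h\ne0$, extended to the points with $\beta_h=0$ by $\sum_{K\not\ni h}e_K\,\partial F_{K\cup\{h\}}/\partial\beta_h$ (the limit of the quotient, as $F_{K\cup\{h\}}$ is odd in $\beta_h$). For $f=\mathcal I(F)$ slice regular, $1\le m\le n$ and $K\subseteq\{1,\dots,m\}$, let $$\mathcal S^m_K(f)=\mathcal I\big((\cdots((Z_K\otimes F)'_1)'_2\cdots)'_m\big):\Omega_D\to\mathbb H .$$ Writing $x_h=a_h+ib_h+jc_h+kd_h$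 with $a_h,b_h,c_h,d_h$ real, let $\Delta_h=\partial_{a_h}^2+\partial_{b_h}^2+\partial_{c_h}^2+\partial_{d_h}^2$ and $$\partial_{x_h}=\tfrac12\big(\partial_{a_h}-i\,\partial_{b_h}-j\,\partial_{c_h}-k\,\partial_{d_h}\big),\qquad \overline\partial_{x_h}=\tfrac12\big(\partial_{a_h}+i\,\partial_{b_h}+j\,\partial_{c_h}+k\,\partial_{d_h}\big).$$ A function $g:\Omega_D\to\mathbb H$ is *axially monogenic in $x_h$* if it is a slice function on $\Omega_D$, is of class $C^1$ on $\Omega_D$, and satisfies $\overline\partial_{x_h}g=0$ on $\Omega_D$. **Proposition.** Let $f$ be slice regular on $\Omega_D$ and $1\le m\le n-1$. Then for every $K\subseteq\{1,\dots,m\}$ the function $\mathcal S^m_K(f)$ is of class $C^2$ on $\Omega_D$ (so that the derivatives below exist), and 1. $\partial_{x_m}\mathcal S^m_K(f)$ is axially monogenic in $x_m$; 2. $\Delta_{m+1}\mathcal S^m_K(f)$ is axially monogenic in $x_{m+1}$. -/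

import Mathlib

open scoped Quaternion symmDiff

noncomputable section

namespace SeveralSlice

variable {n : ℕ}

/-! ### Stem functions

The variables `x_1, …, x_n` are indexed by `Fin n`, so that `x_k` has index `k - 1`.
An element `∑_K e_K ⊗ q_K` of `ℍ ⊗ ℝ^(2^n)` is the family of its components `q_K`.
A function on a subset of `ℂⁿ` (or of `ℍⁿ`) is a function on the whole space, of which only
the values on that subset matter. -/

/-- The elements of `ℍ ⊗ ℝ^(2^n)`. -/
abbrev StemVal (n : ℕ) := Finset (Fin n) → ℍ[ℝ]

/-- The quaternion `i`. -/
def qi : ℍ[ℝ] := ⟨0, 1, 0, 0⟩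
/-- The quaternion `j`. -/
def qj : ℍ[ℝ] := ⟨0, 0, 1, 0⟩
/-- The quaternion `k`. -/
def qk : ℍ[ℝ] := ⟨0, 0, 0, 1⟩

/-- Conjugation of the `h`-th coordinate only. -/
def conjAt (h : Fin n) (z : Fin n → ℂ) : Fin n → ℂ :=
  Function.update z h (starRingEnd ℂ (z h))

/-- `D` is invariant under conjugation of each single coordinate. -/
def ConjInvariant (D : Set (Fin n → ℂ)) : Prop :=
  ∀ (h : Fin n) (z : Fin n → ℂ), z ∈ D ↔ conjAt h z ∈ D

/-- Stem functions on a (conjugation invariant) set `D`. -/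
def IsStem (D : Set (Fin n → ℂ)) (F : (Fin n → ℂ) → StemVal n) : Prop :=
  ∀ z ∈ D, ∀ (h : Fin n) (K : Finset (Fin n)),
    F (conjAt h z) K = (-1 : ℝ) ^ (K ∩ {h}).card • F z K

/-- The product `⊗` of stem functions,
`(F ⊗ G)(z) = ∑_{H,K} (-1)^|H ∩ K| e_{K Δ H} F_K(z) G_H(z)`. -/
def stemMul (F G : (Fin n → ℂ) → StemVal n) : (Fin n → ℂ) → StemVal n :=
  fun z L => ∑ K : Finset (Fin n), ∑ H : Finset (Fin n),
    if K ∆ H = L then (-1 : ℝ) ^ (H ∩ K).card • (F z K * G z H) else 0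

/-- The unit of `⊗`, the constant `e_∅`. -/
def stemOne : (Fin n → ℂ) → StemVal n :=
  fun _ L => if L = ∅ then 1 else 0

/-- `Z_j(z) = α_j + e_j β_j`, where `z_j = α_j + i β_j`. -/
def stemCoord (j : Fin n) : (Fin n → ℂ) → StemVal n :=
  fun z L => if L = ∅ then (((z j).re : ℝ) : ℍ[ℝ])
    else if L = {j} then (((z j).im : ℝ) : ℍ[ℝ]) else 0

/-- The ordered product `Z_K = Z_{k_1} ⊗ ⋯ ⊗ Z_{k_p}`, `K = {k_1 < ⋯ < k_p}`. -/
def stemMonomial (K : Finset (Fin n)) : (Fin n → ℂ) → StemVal n :=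
  ((K.sort (· ≤ ·)).map stemCoord).foldr stemMul stemOne

/-- `∂F/∂α_h`. -/
def dAlpha (h : Fin n) (F : (Fin n → ℂ) → StemVal n) : (Fin n → ℂ) → StemVal n :=
  fun z K => lineDeriv ℝ (fun w => F w K) z (Pi.single h 1)

/-- `∂F/∂β_h`. -/
def dBeta (h : Fin n) (F : (Fin n → ℂ) → StemVal n) : (Fin n → ℂ) → StemVal n :=
  fun z K => lineDeriv ℝ (fun w => F w K) z (Pi.single h Complex.I)

/-- The complex structure `𝒥_h(q ⊗ e_K) = (-1)^|K ∩ {h}| q ⊗ e_{K Δ {h}}`; the `L`-th component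
of the image comes from `K = L Δ {h}`. -/
def cxStr (h : Fin n) (u : StemVal n) : StemVal n :=
  fun L => (-1 : ℝ) ^ ((L ∆ {h}) ∩ {h}).card • u (L ∆ {h})

/-- `∂̄_h F = (1/2) (∂F/∂α_h + 𝒥_h ∂F/∂β_h)`. -/
def stemDbar (h : Fin n) (F : (Fin n → ℂ) → StemVal n) : (Fin n → ℂ) → StemVal n :=
  fun z => (1 / 2 : ℝ) • (dAlpha h F z + cxStr h (dBeta h F z))

/-- Holomorphic functions `D → ℍ ⊗ ℝ^(2^n)`: of class `C¹` with `∂̄_h F = 0` for every `h`. -/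
def IsHolo (D : Set (Fin n → ℂ)) (F : (Fin n → ℂ) → StemVal n) : Prop :=
  ContDiffOn ℝ 1 F D ∧ ∀ h : Fin n, ∀ z ∈ D, stemDbar h F z = 0

/-! ### Slice functions -/

/-- The ordered product `q_K = q_{k_1} ⋯ q_{k_p}`, `K = {k_1 < ⋯ < k_p}`. -/
def ordProd (q : Fin n → ℍ[ℝ]) (K : Finset (Fin n)) : ℍ[ℝ] :=
  ((K.sort (· ≤ ·)).map q).prod

/-- The set `𝕊_ℍ` of square roots of `-1`. -/
def imagUnits : Set ℍ[ℝ] := {J | J * J = -1}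

/-- The point `(α_1 + J_1 β_1, …, α_n + J_n β_n)`, where `z_h = α_h + i β_h`. -/
def slicePoint (z : Fin n → ℂ) (J : Fin n → ℍ[ℝ]) : Fin n → ℍ[ℝ] :=
  fun h => (((z h).re : ℝ) : ℍ[ℝ]) + J h * (((z h).im : ℝ) : ℍ[ℝ])

/-- The circularization `Ω_D` of `D`. -/
def circ (D : Set (Fin n → ℂ)) : Set (Fin n → ℍ[ℝ]) :=
  {x | ∃ z ∈ D, ∃ J : Fin n → ℍ[ℝ], (∀ h, J h ∈ imagUnits) ∧ x = slicePoint z J}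

/-- `f = ℐ(F)` on `Ω_D`: for every `z ∈ D` and all imaginary units `J_1, …, J_n`,
`f(α_1 + J_1 β_1, …, α_n + J_n β_n) = ∑_K J_K F_K(z)`. -/
def Induces (D : Set (Fin n → ℂ)) (F : (Fin n → ℂ) → StemVal n)
    (f : (Fin n → ℍ[ℝ]) → ℍ[ℝ]) : Prop :=
  ∀ z ∈ D, ∀ J : Fin n → ℍ[ℝ], (∀ h, J h ∈ imagUnits) →
    f (slicePoint z J) = ∑ K : Finset (Fin n), ordProd J K * F z K

/-- Slice functions on `Ω_D`. -/
def IsSlice (D : Set (Fin n → ℂ)) (f : (Fin n → ℍ[ℝ]) → ℍ[ℝ]) : Prop :=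
  ∃ F, IsStem D F ∧ Induces D F f

/-- Slice regular functions on `Ω_D`. -/
def IsSliceRegular (D : Set (Fin n → ℂ)) (f : (Fin n → ℍ[ℝ]) → ℍ[ℝ]) : Prop :=
  ∃ F, IsStem D F ∧ IsHolo D F ∧ Induces D F f

open Classical in
/-- `ℐ⁻¹(f)`, the stem function inducing the slice function `f`; on `D` it is unique
(`Induces.unique`). -/
def inducingStem (D : Set (Fin n → ℂ)) (f : (Fin n → ℍ[ℝ]) → ℍ[ℝ]) : (Fin n → ℂ) → StemVal n :=
  if hf : IsSlice D f then hf.choose else 0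

/-- `(Re x_h + i |Im x_h|)_h`. -/
def slicePart (x : Fin n → ℍ[ℝ]) : Fin n → ℂ := fun h => ⟨(x h).re, ‖(x h).im‖⟩

/-- The imaginary units `Im x_h / |Im x_h|`. If `x_h` is real this is `0`, which is harmless in
`induced`: a component `F_K` of a stem function with `h ∈ K` vanishes where `z_h` is real. -/
def sliceUnit (x : Fin n → ℍ[ℝ]) : Fin n → ℍ[ℝ] := fun h => ‖(x h).im‖⁻¹ • (x h).im

/-- The function `ℐ(F)` induced by the stem function `F` (see `induces_induced`). -/
def induced (F : (Fin n → ℂ) → StemVal n) : (Fin n → ℍ[ℝ]) → ℍ[ℝ] :=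
  fun x => ∑ K : Finset (Fin n), ordProd (sliceUnit x) K * F (slicePart x) K

/-! ### Well-definedness of `ℐ` and `ℐ⁻¹` -/

lemma ordProd_smul (s : Fin n → ℝ) (J : Fin n → ℍ[ℝ]) (K : Finset (Fin n)) :
    ordProd (fun h => s h • J h) K = (∏ h ∈ K, s h) • ordProd J K := by
  have h1 : ∏ h ∈ K, s h = ((K.sort (· ≤ ·)).map s).prod := by
    rw [Finset.prod, ← Finset.sort_eq K (· ≤ ·), Multiset.map_coe, Multiset.prod_coe]
  rw [h1]
  unfold ordProd
  induction K.sort (· ≤ ·) with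
  | nil => simp
  | cons a l ih =>
    simp only [List.map_cons, List.prod_cons, ih]
    rw [smul_mul_smul_comm]

lemma IsStem.eq_zero {D : Set (Fin n → ℂ)} {F : (Fin n → ℂ) → StemVal n} (hF : IsStem D F)
    {z : Fin n → ℂ} (hz : z ∈ D) {h : Fin n} (h0 : (z h).im = 0) {K : Finset (Fin n)}
    (hK : h ∈ K) : F z K = 0 := by
  have h1 := hF z hz h K
  have h2 : conjAt h z = z := by
    unfold conjAt
    rw [Complex.conj_eq_iff_im.2 h0, Function.update_eq_self]
  rw [h2, Finset.inter_singleton_of_mem hK] at h1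
  simp only [Finset.card_singleton, pow_one, neg_smul, one_smul] at h1
  have h3 : (2 : ℝ) • F z K = 0 := by
    rw [two_smul]
    nth_rewrite 2 [h1]
    exact add_neg_cancel _
  exact (smul_eq_zero.1 h3).resolve_left two_ne_zero

lemma IsStem.conj_finset {D : Set (Fin n → ℂ)} {F : (Fin n → ℂ) → StemVal n} (hF : IsStem D F)
    (hD : ConjInvariant D) {z : Fin n → ℂ} (hz : z ∈ D) (K N : Finset (Fin n)) :
    (fun h => if h ∈ N then starRingEnd ℂ (z h) else z h) ∈ D ∧
    F (fun h => if h ∈ N then starRingEnd ℂ (z h) else z h) K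
      = (∏ h ∈ K, if h ∈ N then (-1 : ℝ) else 1) • F z K := by
  induction N using Finset.induction_on with
  | empty => simpa using hz
  | insert a N ha ih =>
    have h1 : (fun h => if h ∈ insert a N then starRingEnd ℂ (z h) else z h)
        = conjAt a (fun h => if h ∈ N then starRingEnd ℂ (z h) else z h) := by
      funext h
      unfold conjAt
      by_cases hh : h = a
      · subst hh; simp [ha]
      · simp [hh]
    rw [h1, hF _ ih.1, ih.2, smul_smul]
    refine ⟨(hD a _).1 ih.1, ?_⟩
    congr 1
    have h2 : ∀ h ∈ K, (if h ∈ insert a N then (-1 : ℝ) else 1)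
        = (if h = a then (-1 : ℝ) else 1) * (if h ∈ N then (-1 : ℝ) else 1) := by
      intro h _
      by_cases hh : h = a
      · subst hh; simp [ha]
      · simp [hh]
    rw [Finset.prod_congr rfl h2, Finset.prod_mul_distrib]
    congr 1
    by_cases haK : a ∈ K <;> simp [haK]

lemma imagUnits_spec {J : ℍ[ℝ]} (hJ : J ∈ imagUnits) : J.re = 0 ∧ ‖J‖ = 1 := by
  have h1 : J * J = -1 := hJ
  have hn : ‖J‖ = 1 := by
    have h2 : ‖J‖ * ‖J‖ = 1 := by rw [← norm_mul, h1, norm_neg, norm_one]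
    nlinarith [norm_nonneg J]
  refine ⟨?_, hn⟩
  have h2 := congrArg (fun q : ℍ[ℝ] => q.re) h1
  have h3 : J.re ^ 2 + J.imI ^ 2 + J.imJ ^ 2 + J.imK ^ 2 = 1 := by
    rw [← Quaternion.normSq_def', Quaternion.normSq_eq_norm_mul_self, hn, one_mul]
  simp at h2
  nlinarith

/-- A stem function `F` on `D` induces a well-defined function on `Ω_D`, which is `induced F`. -/
theorem induces_induced {D : Set (Fin n → ℂ)} (hD : ConjInvariant D)
    {F : (Fin n → ℂ) → StemVal n} (hF : IsStem D F) : Induces D F (induced F) := by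
  intro z hz J hJ
  have him : ∀ h, (slicePoint z J h).im = (z h).im • J h := by
    intro h
    have := (imagUnits_spec (hJ h)).1
    ext <;> simp [slicePoint, this, mul_comm]
  have hre : ∀ h, (slicePoint z J h).re = (z h).re := by
    intro h
    simp [slicePoint, (imagUnits_spec (hJ h)).1]
  have hnorm : ∀ h, ‖(slicePoint z J h).im‖ = |(z h).im| := by
    intro h
    rw [him, norm_smul, (imagUnits_spec (hJ h)).2, mul_one, Real.norm_eq_abs]
  set N : Finset (Fin n) := Finset.univ.filter fun h => (z h).im < 0 with hN
  have hpart : slicePart (slicePoint z J)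
      = fun h => if h ∈ N then starRingEnd ℂ (z h) else z h := by
    funext h
    unfold slicePart
    rw [hre, hnorm]
    by_cases hh : (z h).im < 0
    · apply Complex.ext <;> simp [hN, hh, abs_of_neg hh]
    · apply Complex.ext <;> simp [hN, hh, abs_of_nonneg (not_lt.1 hh)]
  have hunit : sliceUnit (slicePoint z J) = fun h => (|(z h).im|⁻¹ * (z h).im) • J h := by
    funext h
    unfold sliceUnit
    rw [hnorm, him, smul_smul]
  unfold induced
  rw [hpart, hunit]
  refine Finset.sum_congr rfl fun K _ => ?_
  rw [ordProd_smul, (hF.conj_finset hD hz K N).2]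
  by_cases h0 : ∃ h ∈ K, (z h).im = 0
  · obtain ⟨h, hK, h0⟩ := h0
    simp [hF.eq_zero hz h0 hK]
  · push Not at h0
    rw [smul_mul_smul_comm, ← Finset.prod_mul_distrib, Finset.prod_eq_one, one_smul]
    intro h hK
    have hne := h0 h hK
    by_cases hh : (z h).im < 0
    · simp only [hN, Finset.mem_filter, Finset.mem_univ, hh, true_and, if_true, abs_of_neg hh]
      field_simp
    · simp [hN, hh, abs_of_nonneg (not_lt.1 hh), hne]

/-- The stem function inducing a given slice function is unique on `D`. -/
theorem Induces.unique {D : Set (Fin n → ℂ)} {F G : (Fin n → ℂ) → StemVal n}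
    {f : (Fin n → ℍ[ℝ]) → ℍ[ℝ]} (hF : Induces D F f) (hG : Induces D G f)
    {z : Fin n → ℂ} (hz : z ∈ D) : F z = G z := by
  obtain ⟨q, hqq⟩ : ∃ q : ℍ[ℝ], q * q = -1 :=
    ⟨qi, by ext <;> simp [Quaternion.re_mul, Quaternion.imI_mul, Quaternion.imJ_mul, Quaternion.imK_mul] <;> simp [qi]⟩
  let c : Finset (Fin n) → Fin n → ℝ := fun N h => if h ∈ N then -1 else 1
  have hsum : ∀ N, ∑ K : Finset (Fin n), (∏ h ∈ K, c N h) •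
      (ordProd (fun _ => q) K * (F z K - G z K)) = 0 := by
    intro N
    have hJ : ∀ h, (fun h => c N h • q) h ∈ imagUnits := by
      intro h
      change (c N h • q) * (c N h • q) = -1
      rw [smul_mul_smul_comm, hqq]
      by_cases hh : h ∈ N <;> simp [c, hh]
    have h1 := (hF z hz _ hJ).symm.trans (hG z hz _ hJ)
    rw [← sub_eq_zero, ← Finset.sum_sub_distrib] at h1
    rw [← h1]
    refine Finset.sum_congr rfl fun K _ => ?_
    rw [ordProd_smul, smul_mul_assoc, smul_mul_assoc, mul_sub, smul_sub]
  have horth : ∀ K L : Finset (Fin n), K ≠ L →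
      ∑ N : Finset (Fin n), (∏ h ∈ L, c N h) * (∏ h ∈ K, c N h) = 0 := by
    intro K L hKL
    let a : Fin n → ℝ := fun h => (if h ∈ L then -1 else 1) * (if h ∈ K then -1 else 1)
    have e : ∀ N M : Finset (Fin n), ∏ h ∈ M, c N h = ∏ h ∈ N, if h ∈ M then (-1 : ℝ) else 1 := by
      intro N M
      simp only [c]
      rw [Finset.prod_ite_mem, Finset.prod_ite_mem, Finset.inter_comm]
    have h1 : ∀ N : Finset (Fin n), (∏ h ∈ L, c N h) * (∏ h ∈ K, c N h) = ∏ h ∈ N, a h := by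
      intro N
      rw [e N L, e N K, ← Finset.prod_mul_distrib]
    simp only [h1]
    rw [← Finset.powerset_univ, ← Finset.prod_one_add]
    obtain ⟨h, hh⟩ : ∃ h, ¬ (h ∈ K ↔ h ∈ L) := by
      by_contra hcon
      push Not at hcon
      exact hKL (Finset.ext hcon)
    refine Finset.prod_eq_zero (Finset.mem_univ h) ?_
    by_cases hk : h ∈ K <;> by_cases hl : h ∈ L <;> simp_all [a]
  funext L
  have h2 : ∑ N : Finset (Fin n), (∏ h ∈ L, c N h) • ∑ K : Finset (Fin n), (∏ h ∈ K, c N h) •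
      (ordProd (fun _ => q) K * (F z K - G z K)) = 0 := by
    simp [hsum]
  simp only [Finset.smul_sum, smul_smul] at h2
  rw [Finset.sum_comm] at h2
  simp only [← Finset.sum_smul] at h2
  rw [Finset.sum_eq_single L (fun K _ hK => by rw [horth K L hK, zero_smul]) (by simp)] at h2
  have hpos : ∑ N : Finset (Fin n), (∏ h ∈ L, c N h) * (∏ h ∈ L, c N h) ≠ 0 := by
    have : ∀ N : Finset (Fin n), (∏ h ∈ L, c N h) * (∏ h ∈ L, c N h) = 1 := by
      intro N
      rw [← Finset.prod_mul_distrib]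
      refine Finset.prod_eq_one fun h _ => ?_
      by_cases hh : h ∈ N <;> simp [c, hh]
    simp [this]
  have h3 := (smul_eq_zero.1 h2).resolve_left hpos
  have hq0 : q ≠ 0 := by
    intro h
    rw [h] at hqq
    simp at hqq
  have hK0 : ordProd (fun _ => q) L ≠ 0 := by
    unfold ordProd
    refine List.prod_ne_zero ?_
    simp [Ne.symm hq0]
  exact sub_eq_zero.1 ((mul_eq_zero.1 h3).resolve_left hK0)

/-! ### Spherical derivatives and components of the Almansi decomposition -/

/-- `F'_h = ∑_{K ∌ h} e_K β_h⁻¹ F_{K ∪ {h}}`, extended to the points with `β_h = 0` by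
`∑_{K ∌ h} e_K ∂F_{K ∪ {h}}/∂β_h`: since `F_{K ∪ {h}}` is odd in `β_h`, this is the limit
of the difference quotient `β_h⁻¹ F_{K ∪ {h}}`. -/
def stemPrime (h : Fin n) (F : (Fin n → ℂ) → StemVal n) : (Fin n → ℂ) → StemVal n :=
  fun z K => if h ∈ K then 0
    else if (z h).im = 0 then dBeta h F z (insert h K)
    else (z h).im⁻¹ • F z (insert h K)

/-- `F'_H = (⋯(F'_{h_1})'_{h_2} ⋯)'_{h_p}`, `H = {h_1 < ⋯ < h_p}`. -/
def stemPrimes (H : Finset (Fin n)) (F : (Fin n → ℂ) → StemVal n) : (Fin n → ℂ) → StemVal n :=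
  (H.sort (· ≤ ·)).foldl (fun G h => stemPrime h G) F

/-- The component `𝒮^H_K(f) = (x_K ⊙ f)'_{s,H}`, that is the function induced by
`(Z_K ⊗ ℐ⁻¹(f))'_H`. -/
def almansi (D : Set (Fin n → ℂ)) (H K : Finset (Fin n)) (f : (Fin n → ℍ[ℝ]) → ℍ[ℝ]) :
    (Fin n → ℍ[ℝ]) → ℍ[ℝ] :=
  induced (stemPrimes H (stemMul (stemMonomial K) (inducingStem D f)))

/-- The set of the first `m` variables. -/
def firstVars (n m : ℕ) : Finset (Fin n) := Finset.univ.filter fun k => (k : ℕ) < m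

/-- The ordered component `𝒮^m_K(f)`. -/
def ordAlmansi (D : Set (Fin n → ℂ)) (m : ℕ) (K : Finset (Fin n))
    (f : (Fin n → ℍ[ℝ]) → ℍ[ℝ]) : (Fin n → ℍ[ℝ]) → ℍ[ℝ] :=
  almansi D (firstVars n m) K f

/-! ### Differential operators -/

/-- Derivative in the variable `x_h` along `v`. For `v = 1, i, j, k` these are the four real
partial derivatives with respect to `x_h`. -/
def partialDir (h : Fin n) (v : ℍ[ℝ]) (f : (Fin n → ℍ[ℝ]) → ℍ[ℝ]) : (Fin n → ℍ[ℝ]) → ℍ[ℝ] :=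
  fun x => lineDeriv ℝ f x (Pi.single h v)

/-- `∂_{x_h}`. -/
def crf (h : Fin n) (f : (Fin n → ℍ[ℝ]) → ℍ[ℝ]) : (Fin n → ℍ[ℝ]) → ℍ[ℝ] :=
  fun x => (1 / 2 : ℝ) • (partialDir h 1 f x - qi * partialDir h qi f x
    - qj * partialDir h qj f x - qk * partialDir h qk f x)

/-- The Cauchy–Riemann–Fueter operator `∂̄_{x_h}`. -/
def crfBar (h : Fin n) (f : (Fin n → ℍ[ℝ]) → ℍ[ℝ]) : (Fin n → ℍ[ℝ]) → ℍ[ℝ] :=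
  fun x => (1 / 2 : ℝ) • (partialDir h 1 f x + qi * partialDir h qi f x
    + qj * partialDir h qj f x + qk * partialDir h qk f x)

/-- The Laplacian `Δ_h` in the four real coordinates of `x_h`. -/
def lapl (h : Fin n) (f : (Fin n → ℍ[ℝ]) → ℍ[ℝ]) : (Fin n → ℍ[ℝ]) → ℍ[ℝ] :=
  fun x => partialDir h 1 (partialDir h 1 f) x + partialDir h qi (partialDir h qi f) x
    + partialDir h qj (partialDir h qj f) x + partialDir h qk (partialDir h qk f) x

/-- `𝒜ℳ_h(Ω_D)`: the slice functions on `Ω_D` of class `C¹` that are monogenic with respect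
to `x_h`. -/
def IsAxiallyMonogenic (D : Set (Fin n → ℂ)) (h : Fin n) (f : (Fin n → ℍ[ℝ]) → ℍ[ℝ]) : Prop :=
  IsSlice D f ∧ ContDiffOn ℝ 1 f (circ D) ∧ ∀ x ∈ circ D, crfBar h f x = 0

end SeveralSlice

end

noncomputable section

namespace SeveralSlice

/-! ### The Cauchy formula on a torus -/

/-! Write G for the stem function Z_K ⊗ F. The substitution e_L ↦ i^|L| respects ⊗ and carries 𝒥_h
to multiplication by i. Hence for every real functional λ on ℍ the function `stemPhi λ G` is an
ordinary holomorphic function of z, and Z_K acts on it as the monomial z_K.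

The Cauchy kernel splits by parity in β: with k = 1/((ζ - α)² + β²), one has 1/(ζ - w) = (ζ - α)k +
iβk. Inserting this in the Cauchy formula around a point and all its coordinate conjugates, and
separating parities by characters of (ℤ/2)ⁿ, gives G_L = (∏_{h ∈ L} β_h) A_L. Locally A_L is a fixed
linear functional applied to a product of factors k (for h ∈ L) and (ζ - α)k (for h ∉ L); see
`exists_local_representation`. As a function of x, A_L involves only the squares |Im x_h|², so it is
smooth even at real points. Since k is harmonic in the four coordinates of x_h, Δ_h A_L = 0 if h ∈
L, and Δ_h A_L = -2 ∂A_{L ∪ {h}}/∂a_h if h ∉ L (`sum_qKerSnd`, `sum_qCoKerSnd`).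

A spherical derivative merely deletes a factor β_h. So with H = {1, …, m} the Almansi component is
the sum over L disjoint from H of Im(x)_L A_{L ∪ H}, which is `axSum`. For h ∈ H the factor Im(x)_L
does not contain x_h, so the sum is harmonic in x_h, and Δ_h = 4 ∂̄∂ makes its ∂_{x_h} monogenic. It
is also a slice function when h = m: the imaginary gradient of A_{L ∪ H} is parallel to Im x_h, and
m precedes every index of L, so the new factor Im x_h stands at the left end of the ordered product
(`isSlice_crf_axSum`). For h = m + 1, separating the L that contain h writes the sum as Q + Im(x_h)
R, where R is the sum belonging to H ∪ {h}. Then Δ_h of it is -4 ∂_{x_h} R (`lapl_axSum_eq`), so the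
second claim reduces to the first. -/

lemma torusMap_mem_closedBall {n : ℕ} (c : Fin n → ℂ) {r : ℝ} (hr : 0 < r) (θ : Fin n → ℝ) :
    torusMap c (fun _ => r) θ ∈ Metric.closedBall c r := by
  rw [Metric.mem_closedBall, dist_pi_le_iff hr.le]
  intro h
  simp [torusMap, dist_eq_norm, abs_of_pos hr]

lemma dist_torusMap {n : ℕ} (c : Fin n → ℂ) {r : ℝ} (hr : 0 < r) (θ : Fin n → ℝ) (h : Fin n) :
    dist (torusMap c (fun _ => r) θ h) (c h) = r := by
  simp [torusMap, dist_eq_norm, abs_of_pos hr]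

lemma continuous_torusMap {n : ℕ} (c : Fin n → ℂ) (R : Fin n → ℝ) :
    Continuous (torusMap c R) := by
  unfold torusMap
  fun_prop

lemma cons_mem_closedBall {n : ℕ} {c : Fin (n + 1) → ℂ} {r : ℝ} {x : ℂ}
    {y : Fin n → ℂ} (hx : x ∈ Metric.closedBall (c 0) r)
    (hy : y ∈ Metric.closedBall (c ∘ Fin.succ) r) :
    (Fin.cons x y : Fin (n + 1) → ℂ) ∈ Metric.closedBall c r := by
  have hr : 0 ≤ r := dist_nonneg.trans hx
  rw [Metric.mem_closedBall, dist_pi_le_iff hr] at *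
  intro i
  refine Fin.cases ?_ (fun j => ?_) i
  · simpa using hx
  · simpa using hy j

lemma continuous_cons {n : ℕ} :
    Continuous fun p : ℂ × (Fin n → ℂ) => (Fin.cons p.1 p.2 : Fin (n + 1) → ℂ) := by
  refine continuous_pi fun i => Fin.cases ?_ (fun j => ?_) i
  · simpa using continuous_fst
  · simp only [Fin.cons_succ]
    fun_prop

open Classical in
/-- The Cauchy formula on a torus, for separately holomorphic functions. -/
theorem torusIntegral_prod_sub_inv_mul {n : ℕ} {f : (Fin n → ℂ) → ℂ} {c w : Fin n → ℂ} {r : ℝ}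
    (hr : 0 < r) (hc : ContinuousOn f (Metric.closedBall c r))
    (hd : ∀ z ∈ Metric.closedBall c r, ∀ h : Fin n,
      DifferentiableAt ℂ (fun t => f (Function.update z h t)) (z h))
    (hw : ∀ h, dist (w h) (c h) ≠ r) :
    (∯ z in T(c, fun _ => r), (∏ h, (z h - w h)⁻¹) * f z) =
      if w ∈ Metric.ball c r then (2 * Real.pi * Complex.I) ^ n * f w else 0 := by
  induction n with
  | zero =>
    rw [torusIntegral_dim0, Subsingleton.elim w c]
    simp [hr]
  | succ n ih =>
    have hmem : (w ∈ Metric.ball c r) ↔ (w 0 ∈ Metric.ball (c 0) r ∧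
        w ∘ Fin.succ ∈ Metric.ball (c ∘ Fin.succ) r) := by
      simp only [Metric.mem_ball, dist_pi_lt_iff hr, Fin.forall_fin_succ, Function.comp]
    have hint : TorusIntegrable (fun z => (∏ h, (z h - w h)⁻¹) * f z) c (fun _ => r) := by
      refine ContinuousOn.integrableOn_compact isCompact_Icc (ContinuousOn.mul ?_ ?_)
      · refine Continuous.continuousOn (continuous_finsetProd _ fun h _ => ?_)
        refine Continuous.inv₀ ?_ fun θ h0 => hw h ?_
        · have := continuous_torusMap c fun _ => r
          fun_prop
        · rw [← sub_eq_zero.1 h0, dist_torusMap c hr]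
      · exact hc.comp (continuous_torusMap c _).continuousOn fun θ _ =>
          torusMap_mem_closedBall c hr θ
    rw [torusIntegral_succ hint]
    -- Freezing the first coordinate leaves a torus integral in one dimension less, which the
    -- induction hypothesis evaluates.
    have hinner : ∀ x ∈ Metric.closedBall (c 0) r,
        (∯ y in T(c ∘ Fin.succ, (fun _ => r) ∘ Fin.succ),
          (∏ h, ((Fin.cons x y : Fin (n + 1) → ℂ) h - w h)⁻¹) * f (Fin.cons x y)) =
        (x - w 0)⁻¹ • (if w ∘ Fin.succ ∈ Metric.ball (c ∘ Fin.succ) r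
          then (2 * Real.pi * Complex.I) ^ n * f (Fin.cons x (w ∘ Fin.succ)) else 0) := by
      intro x hx
      have h1 := ih (f := fun y => f (Fin.cons x y)) (c := c ∘ Fin.succ) (w := w ∘ Fin.succ)
        (hc.comp (continuous_cons.comp (Continuous.prodMk_right x)).continuousOn
          fun y hy => cons_mem_closedBall hx hy)
        (fun y hy h => by
          have := hd _ (cons_mem_closedBall hx hy) h.succ
          simpa [Fin.cons_update] using this)
        (fun h => hw h.succ)
      rw [← h1, smul_eq_mul, ← torusIntegral_const_mul]
      simp only [Fin.prod_univ_succ, Fin.cons_zero, Fin.cons_succ, Function.comp, mul_assoc]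
      rfl
    rw [circleIntegral.integral_congr hr.le
      fun x hx => hinner x (Metric.sphere_subset_closedBall hx)]
    by_cases h1 : w ∘ Fin.succ ∈ Metric.ball (c ∘ Fin.succ) r
    · have hcons : w = Fin.cons (w 0) (w ∘ Fin.succ) := (Fin.cons_self_tail w).symm
      have hcont : ContinuousOn (fun x => (2 * Real.pi * Complex.I) ^ n *
          f (Fin.cons x (w ∘ Fin.succ))) (Metric.closedBall (c 0) r) := by
        refine continuousOn_const.mul (hc.comp (continuous_cons.comp
          (Continuous.prodMk_left (w ∘ Fin.succ))).continuousOn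
          fun x hx => cons_mem_closedBall hx (Metric.ball_subset_closedBall h1))
      have hdiff : ∀ x ∈ Metric.closedBall (c 0) r, DifferentiableAt ℂ
          (fun x => (2 * Real.pi * Complex.I) ^ n * f (Fin.cons x (w ∘ Fin.succ))) x := by
        intro x hx
        have := hd _ (cons_mem_closedBall hx (Metric.ball_subset_closedBall h1)) 0
        simp only [Fin.update_cons_zero, Fin.cons_zero] at this
        exact this.const_mul _
      simp only [if_pos h1]
      by_cases h0 : w 0 ∈ Metric.ball (c 0) r
      · rw [if_pos (hmem.2 ⟨h0, h1⟩),
          Complex.circleIntegral_sub_inv_smul_of_differentiable_on_off_countable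
          Set.countable_empty h0 hcont fun x hx => hdiff x (Metric.ball_subset_closedBall hx.1)]
        rw [← hcons, smul_eq_mul, pow_succ]
        ring
      · rw [if_neg fun h => h0 (hmem.1 h).1]
        -- Here `w 0` is not in the open disc and, by `hw`, not on its boundary, so the kernel has
        -- no pole in the closed disc.
        have hne : ∀ x ∈ Metric.closedBall (c 0) r, x - w 0 ≠ 0 := by
          intro x hx h
          rw [sub_eq_zero.1 h] at hx
          exact hw 0 (le_antisymm hx (not_lt.1 h0))
        refine Complex.circleIntegral_eq_zero_of_differentiable_on_off_countable hr.le
          Set.countable_empty ?_ ?_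
        · exact ((continuousOn_id.sub continuousOn_const).inv₀ hne).smul hcont
        · intro x hx
          have hx' := Metric.ball_subset_closedBall hx.1
          have hi : DifferentiableAt ℂ (fun x : ℂ => (x - w 0)⁻¹) x :=
            (differentiableAt_id.sub_const _).inv (hne x hx')
          exact hi.smul (hdiff x hx')
    · rw [if_neg fun h => h1 (hmem.1 h).2]
      simp only [if_neg h1, smul_zero]
      simp [circleIntegral]

variable {n : ℕ}

/-! ### Products of stem functions -/

lemma neg_one_pow_card_symmDiff_inter (K H : Finset (Fin n)) (h : Fin n) :
    (-1 : ℝ) ^ ((K ∆ H) ∩ {h}).card = (-1) ^ (K ∩ {h}).card * (-1) ^ (H ∩ {h}).card := by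
  by_cases hK : h ∈ K <;> by_cases hH : h ∈ H <;> simp [Finset.mem_symmDiff, hK, hH]

lemma IsStem.stemMul {D : Set (Fin n → ℂ)} {F G : (Fin n → ℂ) → StemVal n} (hF : IsStem D F)
    (hG : IsStem D G) : IsStem D (stemMul F G) := by
  intro z hz h L
  unfold SeveralSlice.stemMul
  simp only [Finset.smul_sum]
  refine Finset.sum_congr rfl fun K _ => Finset.sum_congr rfl fun H _ => ?_
  split_ifs with hL
  · rw [hF z hz, hG z hz, ← hL, neg_one_pow_card_symmDiff_inter, smul_mul_smul_comm, smul_comm]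
  · simp

lemma isStem_stemOne (D : Set (Fin n → ℂ)) : IsStem D stemOne := by
  intro z _ h K
  by_cases hK : K = ∅ <;> simp [stemOne, hK]

lemma isStem_stemCoord (D : Set (Fin n → ℂ)) (j : Fin n) : IsStem D (stemCoord j) := by
  intro z _ h K
  by_cases hK : K = ∅
  · by_cases hj : j = h
    · subst hj; simp [stemCoord, conjAt, hK]
    · simp [stemCoord, conjAt, hK, Function.update_of_ne hj]
  · by_cases hK' : K = {j}
    · subst hK'
      by_cases hj : j = h
      · subst hj; simp [stemCoord, conjAt]
      · simp [stemCoord, conjAt, Function.update_of_ne hj, Ne.symm hj]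
    · simp [stemCoord, hK, hK']

lemma isStem_stemMonomial (D : Set (Fin n → ℂ)) (K : Finset (Fin n)) :
    IsStem D (stemMonomial K) := by
  unfold stemMonomial
  induction K.sort (· ≤ ·) with
  | nil => exact isStem_stemOne D
  | cons a l ih => exact (isStem_stemCoord D a).stemMul ih

/-- The real part, as a continuous linear functional. -/
def reL : ℍ[ℝ] →L[ℝ] ℝ := ⟨QuaternionAlgebra.reₗ _ _ _, Quaternion.continuous_re⟩
/-- The coefficient of `i`, as a continuous linear functional. -/
def imIL : ℍ[ℝ] →L[ℝ] ℝ := ⟨QuaternionAlgebra.imIₗ _ _ _, Quaternion.continuous_imI⟩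
/-- The coefficient of `j`, as a continuous linear functional. -/
def imJL : ℍ[ℝ] →L[ℝ] ℝ := ⟨QuaternionAlgebra.imJₗ _ _ _, Quaternion.continuous_imJ⟩
/-- The coefficient of `k`, as a continuous linear functional. -/
def imKL : ℍ[ℝ] →L[ℝ] ℝ := ⟨QuaternionAlgebra.imKₗ _ _ _, Quaternion.continuous_imK⟩

@[simp] lemma reL_apply (q : ℍ[ℝ]) : reL q = q.re := rfl
@[simp] lemma imIL_apply (q : ℍ[ℝ]) : imIL q = q.imI := rfl
@[simp] lemma imJL_apply (q : ℍ[ℝ]) : imJL q = q.imJ := rfl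
@[simp] lemma imKL_apply (q : ℍ[ℝ]) : imKL q = q.imK := rfl

@[simp] lemma qi_re : qi.re = 0 := rfl
@[simp] lemma qi_imI : qi.imI = 1 := rfl
@[simp] lemma qi_imJ : qi.imJ = 0 := rfl
@[simp] lemma qi_imK : qi.imK = 0 := rfl
@[simp] lemma qj_re : qj.re = 0 := rfl
@[simp] lemma qj_imI : qj.imI = 0 := rfl
@[simp] lemma qj_imJ : qj.imJ = 1 := rfl
@[simp] lemma qj_imK : qj.imK = 0 := rfl
@[simp] lemma qk_re : qk.re = 0 := rfl
@[simp] lemma qk_imI : qk.imI = 0 := rfl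
@[simp] lemma qk_imJ : qk.imJ = 0 := rfl
@[simp] lemma qk_imK : qk.imK = 1 := rfl

/-- The complex function `∑_K i^|K| λ(F_K)` attached to a stem function and a real functional. -/
def stemPhi (lam : ℍ[ℝ] →L[ℝ] ℝ) (F : (Fin n → ℂ) → StemVal n) (z : Fin n → ℂ) : ℂ :=
  ∑ K : Finset (Fin n), Complex.I ^ K.card * (lam (F z K) : ℂ)

/-- The identity |K Δ H| + 2|H ∩ K| = |K| + |H| shows that the sign in the definition of ⊗ is
exactly the one that makes e_K ↦ i^|K| multiplicative. -/
lemma I_pow_card_symmDiff (K H : Finset (Fin n)) :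
    Complex.I ^ (K ∆ H).card * (-1) ^ (H ∩ K).card = Complex.I ^ K.card * Complex.I ^ H.card := by
  have h1 : (K ∆ H).card + 2 * (H ∩ K).card = K.card + H.card := by
    have h2 : (K ∆ H).card = (K \ H).card + (H \ K).card := by
      rw [symmDiff_def, Finset.sup_eq_union,
        Finset.card_union_of_disjoint disjoint_sdiff_sdiff]
    have h3 := Finset.card_sdiff_add_card_inter K H
    have h4 := Finset.card_sdiff_add_card_inter H K
    rw [Finset.inter_comm] at h3
    omega
  rw [← pow_add, ← h1, pow_add, pow_mul, Complex.I_sq]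

/-- Real components of the left factor pass through the real linear functional `lam`; for general
quaternionic ones multiplicativity would fail. -/
lemma stemPhi_stemMul (lam : ℍ[ℝ] →L[ℝ] ℝ) {F G : (Fin n → ℂ) → StemVal n} {z : Fin n → ℂ}
    (hF : ∀ K, F z K = ((F z K).re : ℍ[ℝ])) :
    stemPhi lam (stemMul F G) z = stemPhi reL F z * stemPhi lam G z := by
  have hterm : ∀ K H : Finset (Fin n), lam ((-1 : ℝ) ^ (H ∩ K).card • (F z K * G z H)) =
      (-1) ^ (H ∩ K).card * ((F z K).re * lam (G z H)) := by
    intro K H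
    conv_lhs => rw [hF K]
    rw [Quaternion.coe_mul_eq_smul, map_smul, map_smul, smul_eq_mul, smul_eq_mul]
  unfold stemPhi stemMul
  rw [Finset.sum_mul_sum]
  simp only [map_sum, apply_ite lam, map_zero, hterm, Complex.ofReal_sum, Finset.mul_sum]
  rw [Finset.sum_comm]
  refine Finset.sum_congr rfl fun K _ => ?_
  rw [Finset.sum_comm]
  refine Finset.sum_congr rfl fun H _ => ?_
  rw [Finset.sum_eq_single (K ∆ H)]
  · rw [if_pos rfl]
    push_cast
    have := I_pow_card_symmDiff K H
    simp only [reL_apply]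
    linear_combination ((F z K).re * lam (G z H) : ℂ) * this
  · intro L _ hL
    simp [Ne.symm hL]
  · simp

lemma stemMul_real {F G : (Fin n → ℂ) → StemVal n} {z : Fin n → ℂ}
    (hF : ∀ K, F z K = ((F z K).re : ℍ[ℝ])) (hG : ∀ K, G z K = ((G z K).re : ℍ[ℝ]))
    (L : Finset (Fin n)) : stemMul F G z L = ((stemMul F G z L).re : ℍ[ℝ]) := by
  have h1 : ∀ q : ℍ[ℝ], q = (q.re : ℍ[ℝ]) ↔ q ∈ Set.range (algebraMap ℝ ℍ[ℝ]) := by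
    intro q
    constructor
    · intro h; exact ⟨q.re, h.symm⟩
    · rintro ⟨r, rfl⟩; rfl
  rw [h1]
  change _ ∈ (algebraMap ℝ ℍ[ℝ]).range
  refine sum_mem fun K _ => sum_mem fun H _ => ?_
  split_ifs
  · obtain ⟨a, ha⟩ := (h1 _).1 (hF K)
    obtain ⟨b, hb⟩ := (h1 _).1 (hG H)
    refine ⟨(-1) ^ (H ∩ K).card * (a * b), ?_⟩
    rw [← ha, ← hb, Algebra.smul_def, map_mul, map_mul]
  · exact zero_mem _

lemma stemCoord_real (j : Fin n) (z : Fin n → ℂ) (L : Finset (Fin n)) :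
    stemCoord j z L = ((stemCoord j z L).re : ℍ[ℝ]) := by
  unfold stemCoord
  split_ifs <;> simp

lemma stemPhi_stemCoord (j : Fin n) (z : Fin n → ℂ) : stemPhi reL (stemCoord j) z = z j := by
  unfold stemPhi stemCoord
  rw [← Finset.sum_subset (Finset.subset_univ {∅, {j}})]
  · rw [Finset.sum_pair (by simp)]
    simp [mul_comm Complex.I, Complex.re_add_im]
  · intro K _ hK
    simp only [Finset.mem_insert, Finset.mem_singleton, not_or] at hK
    simp [hK.1, hK.2]

lemma stemPhi_stemMonomial_stemMul (lam : ℍ[ℝ] →L[ℝ] ℝ) (K : Finset (Fin n))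
    (F : (Fin n → ℂ) → StemVal n) (z : Fin n → ℂ) :
    stemPhi lam (stemMul (stemMonomial K) F) z =
      ((K.sort (· ≤ ·)).map z).prod * stemPhi lam F z := by
  -- Reality of all components is carried along the induction because `stemPhi_stemMul` requires it
  -- of each left factor.
  have key : ∀ l : List (Fin n),
      (∀ L, (l.map stemCoord).foldr stemMul stemOne z L =
        (((l.map stemCoord).foldr stemMul stemOne z L).re : ℍ[ℝ])) ∧
      stemPhi reL ((l.map stemCoord).foldr stemMul stemOne) z = (l.map z).prod := by
    intro l
    induction l with
    | nil =>
      refine ⟨fun L => ?_, ?_⟩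
      · by_cases hL : L = ∅ <;> simp [stemOne, hL]
      · simp only [List.map_nil, List.foldr_nil, List.prod_nil, stemPhi, stemOne]
        rw [Finset.sum_eq_single ∅] <;> simp +contextual
    | cons a l ih =>
      refine ⟨stemMul_real (stemCoord_real a z) ih.1, ?_⟩
      simp only [List.map_cons, List.foldr_cons, List.prod_cons]
      rw [stemPhi_stemMul _ (stemCoord_real a z), stemPhi_stemCoord, ih.2]
  rw [stemPhi_stemMul lam (F := stemMonomial K) (key _).1]
  exact congrArg (· * _) (key _).2

/-! ### Sign changes -/

/-- Conjugation of the coordinates in `N`. -/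
def conjOn (N : Finset (Fin n)) (z : Fin n → ℂ) : Fin n → ℂ :=
  fun h => if h ∈ N then starRingEnd ℂ (z h) else z h

/-- The sign `-1` on `N` and `1` elsewhere. -/
def sgnOn (N : Finset (Fin n)) (h : Fin n) : ℝ := if h ∈ N then -1 else 1

lemma IsStem.conjOn_mem {D : Set (Fin n → ℂ)} (hD : ConjInvariant D) {z : Fin n → ℂ}
    (hz : z ∈ D) (N : Finset (Fin n)) : conjOn N z ∈ D :=
  (IsStem.conj_finset (F := 0) (fun _ _ _ _ => by simp) hD hz ∅ N).1

/-- Conjugating the coordinates in N multiplies the K-th term by a character of (ℤ/2)ⁿ. The values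
at all conjugates of z are therefore a Fourier transform of the components at z. -/
lemma stemPhi_conjOn {D : Set (Fin n → ℂ)} (hD : ConjInvariant D)
    {F : (Fin n → ℂ) → StemVal n} (hF : IsStem D F) (lam : ℍ[ℝ] →L[ℝ] ℝ) {z : Fin n → ℂ}
    (hz : z ∈ D) (N : Finset (Fin n)) : stemPhi lam F (conjOn N z) =
      ∑ K : Finset (Fin n), (∏ h ∈ K, sgnOn N h : ℝ) * (Complex.I ^ K.card * lam (F z K)) := by
  unfold stemPhi
  refine Finset.sum_congr rfl fun K _ => ?_
  have h1 := (hF.conj_finset hD hz K N).2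
  unfold conjOn
  rw [h1, map_smul, smul_eq_mul]
  unfold sgnOn
  push_cast
  ring

/-- Orthogonality of characters: the sum over N factors as a product over h of one plus a sign, and
the factor at an index belonging to just one of K and L is zero. -/
lemma sum_prod_sgnOn_mul {K L : Finset (Fin n)} (hKL : K ≠ L) :
    ∑ N : Finset (Fin n), (∏ h ∈ L, sgnOn N h) * (∏ h ∈ K, sgnOn N h) = 0 := by
  have e : ∀ N M : Finset (Fin n), ∏ h ∈ M, sgnOn N h = ∏ h ∈ N, sgnOn M h := by
    intro N M
    simp only [sgnOn]
    rw [Finset.prod_ite_mem, Finset.prod_ite_mem, Finset.inter_comm]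
  have h1 : ∀ N : Finset (Fin n), (∏ h ∈ L, sgnOn N h) * (∏ h ∈ K, sgnOn N h)
      = ∏ h ∈ N, sgnOn L h * sgnOn K h := by
    intro N
    rw [e N L, e N K, ← Finset.prod_mul_distrib]
  simp only [h1]
  rw [← Finset.powerset_univ, ← Finset.prod_one_add]
  obtain ⟨h, hh⟩ : ∃ h, ¬ (h ∈ K ↔ h ∈ L) := by
    by_contra hcon
    push Not at hcon
    exact hKL (Finset.ext hcon)
  refine Finset.prod_eq_zero (Finset.mem_univ h) ?_
  by_cases hk : h ∈ K <;> by_cases hl : h ∈ L <;> simp_all [sgnOn]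

lemma prod_sgnOn_mul_self (N L : Finset (Fin n)) :
    (∏ h ∈ L, sgnOn N h) * (∏ h ∈ L, sgnOn N h) = 1 := by
  rw [← Finset.prod_mul_distrib]
  refine Finset.prod_eq_one fun h _ => ?_
  by_cases hh : h ∈ N <;> simp [sgnOn, hh]

/-- Fourier inversion on (ℤ/2)ⁿ. -/
lemma eq_of_sum_prod_sgnOn_mul {u v : Finset (Fin n) → ℂ}
    (h : ∀ N, ∑ K : Finset (Fin n), ((∏ h ∈ K, sgnOn N h : ℝ) : ℂ) * u K =
      ∑ K : Finset (Fin n), ((∏ h ∈ K, sgnOn N h : ℝ) : ℂ) * v K) : u = v := by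
  have key : ∀ (w : Finset (Fin n) → ℂ) (L : Finset (Fin n)),
      ∑ N : Finset (Fin n), ((∏ h ∈ L, sgnOn N h : ℝ) : ℂ) *
        ∑ K : Finset (Fin n), ((∏ h ∈ K, sgnOn N h : ℝ) : ℂ) * w K =
      (Fintype.card (Finset (Fin n)) : ℂ) * w L := by
    intro w L
    simp only [Finset.mul_sum, ← mul_assoc]
    rw [Finset.sum_comm]
    simp only [← Finset.sum_mul, ← Complex.ofReal_mul, ← Complex.ofReal_sum]
    rw [Finset.sum_eq_single L (fun K _ hK => by rw [sum_prod_sgnOn_mul hK]; simp) (by simp)]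
    simp [prod_sgnOn_mul_self]
  funext L
  have h1 := key u L
  simp only [h, key v L] at h1
  have h2 : (Fintype.card (Finset (Fin n)) : ℂ) ≠ 0 := by simp
  exact (mul_left_cancel₀ h2 h1).symm

/-! ### Holomorphy of the attached complex functions -/

lemma contDiffOn_component {D : Set (Fin n → ℂ)} {F : (Fin n → ℂ) → StemVal n}
    (hF : ContDiffOn ℝ 1 F D) (K : Finset (Fin n)) : ContDiffOn ℝ 1 (fun z => F z K) D :=
  contDiffOn_pi.1 hF K

lemma continuousOn_stemPhi {D : Set (Fin n → ℂ)} {F : (Fin n → ℂ) → StemVal n}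
    (hF : ContDiffOn ℝ 1 F D) (lam : ℍ[ℝ] →L[ℝ] ℝ) : ContinuousOn (stemPhi lam F) D := by
  refine continuousOn_finsetSum _ fun K _ => continuousOn_const.mul ?_
  exact (Complex.continuous_ofReal.comp lam.continuous).comp_continuousOn
    (contDiffOn_component hF K).continuousOn

lemma IsHolo.cauchyRiemann {D : Set (Fin n → ℂ)} {F : (Fin n → ℂ) → StemVal n}
    (hF : IsHolo D F) {z : Fin n → ℂ} (hz : z ∈ D) (h : Fin n) (L : Finset (Fin n)) :
    dAlpha h F z L = if h ∈ L then -dBeta h F z (L ∆ {h}) else dBeta h F z (L ∆ {h}) := by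
  have h1 := congrFun (hF.2 h z hz) L
  simp only [stemDbar, cxStr, Pi.smul_apply, Pi.add_apply, Pi.zero_apply, one_div] at h1
  have h2 := (smul_eq_zero.1 h1).resolve_left (by norm_num)
  by_cases hL : h ∈ L
  · rw [if_pos hL]
    have : (L ∆ {h}) ∩ {h} = ∅ := by
      ext x; simp only [Finset.mem_inter, Finset.mem_symmDiff, Finset.mem_singleton]; aesop
    simp only [this, Finset.card_empty, pow_zero, one_smul] at h2
    exact eq_neg_of_add_eq_zero_left h2
  · rw [if_neg hL]
    have : (L ∆ {h}) ∩ {h} = {h} := by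
      ext x; simp only [Finset.mem_inter, Finset.mem_symmDiff, Finset.mem_singleton]; aesop
    simp only [this, Finset.card_singleton, pow_one, neg_smul, one_smul] at h2
    exact sub_eq_zero.1 (by rw [sub_eq_add_neg]; exact h2)

/-- Under e_K ↦ i^|K| the structure 𝒥_h becomes multiplication by i, so the equation for F becomes
the Cauchy–Riemann equation in z_h. -/
lemma IsHolo.differentiableAt_stemPhi {D : Set (Fin n → ℂ)} (hD : IsOpen D)
    {F : (Fin n → ℂ) → StemVal n} (hF : IsHolo D F) (lam : ℍ[ℝ] →L[ℝ] ℝ) {z : Fin n → ℂ}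
    (hz : z ∈ D) (h : Fin n) :
    DifferentiableAt ℂ (fun t => stemPhi lam F (Function.update z h t)) (z h) := by
  have hd : ∀ K, DifferentiableAt ℝ (fun t => F (Function.update z h t) K) (z h) := by
    intro K
    have h1 : DifferentiableAt ℝ (fun w => F w K) (Function.update z h (z h)) := by
      rw [Function.update_eq_self]
      exact ((contDiffOn_component hF.1 K).differentiableOn one_ne_zero).differentiableAt
        (hD.mem_nhds hz)
    exact h1.comp (z h) (hasFDerivAt_update z (z h)).differentiableAt
  have hf : ∀ K (v : ℂ), fderiv ℝ (fun t => F (Function.update z h t) K) (z h) v =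
      lineDeriv ℝ (fun w => F w K) z (Pi.single h v) := by
    intro K v
    rw [← (hd K).lineDeriv_eq_fderiv]
    unfold lineDeriv
    congr 1
    funext t
    change F (Function.update z h (z h + t • v)) K = F (z + t • (Pi.single h v : Fin n → ℂ)) K
    congr 1
    funext k
    by_cases hk : k = h
    · subst hk; simp
    · simp [hk]
  have hasf : HasFDerivAt (fun t => stemPhi lam F (Function.update z h t))
      (∑ K : Finset (Fin n), Complex.I ^ K.card • (Complex.ofRealCLM.comp (lam.comp
        (fderiv ℝ (fun t => F (Function.update z h t) K) (z h))))) (z h) := by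
    unfold stemPhi
    refine HasFDerivAt.fun_sum fun K _ => ?_
    refine HasFDerivAt.const_mul ?_ _
    exact Complex.ofRealCLM.hasFDerivAt.comp (z h) (lam.hasFDerivAt.comp (z h) (hd K).hasFDerivAt)
  rw [differentiableAt_complex_iff_differentiableAt_real]
  refine ⟨hasf.differentiableAt, ?_⟩
  rw [hasf.fderiv]
  simp only [_root_.sum_apply, _root_.smul_apply,
    ContinuousLinearMap.comp_apply, hf, smul_eq_mul, Finset.mul_sum, Complex.ofRealCLM_apply]
  have hbij : Function.Involutive fun L : Finset (Fin n) => L ∆ {h} := by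
    intro L
    exact symmDiff_symmDiff_cancel_right _ _
  -- The β-derivative of the component `L ∆ {h}` matches the α-derivative of the component `L`, so
  -- one side is reindexed by this involution.
  rw [← Equiv.sum_comp (hbij.toPerm _)]
  refine Finset.sum_congr rfl fun L _ => ?_
  have hcr := hF.cauchyRiemann hz h L
  unfold dAlpha dBeta at hcr
  simp only [Function.Involutive.coe_toPerm]
  rw [hcr]
  by_cases hL : h ∈ L
  · have hc : (L ∆ {h}).card + 1 = L.card := by
      have : L ∆ {h} = L.erase h := by
        ext x; simp only [Finset.mem_symmDiff, Finset.mem_singleton, Finset.mem_erase]; aesop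
      rw [this, Finset.card_erase_add_one hL]
    rw [if_pos hL, ← hc, pow_succ, map_neg]
    push_cast
    linear_combination ((Complex.I ^ (L ∆ {h}).card * (lam (lineDeriv ℝ
      (fun w => F w (L ∆ {h})) z (Pi.single h Complex.I))) : ℂ)) * Complex.I_mul_I
  · have hc : (L ∆ {h}).card = L.card + 1 := by
      have : L ∆ {h} = insert h L := by
        ext x; simp only [Finset.mem_symmDiff, Finset.mem_singleton, Finset.mem_insert]; aesop
      rw [this, Finset.card_insert_of_notMem hL]
    rw [if_neg hL, hc, pow_succ]
    ring

/-! ### Kernels in a Banach algebra -/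

section Kernel

variable {𝔸 : Type*} [NormedCommRing 𝔸] [NormedAlgebra ℝ 𝔸]

/-- `(ζ - α)² + ρ`. -/
def axDen (ζ : 𝔸) (α ρ : ℝ) : 𝔸 := (ζ - algebraMap ℝ 𝔸 α) ^ 2 + algebraMap ℝ 𝔸 ρ

/-- `((ζ - α)² + ρ)⁻¹`. -/
def axKer (ζ : 𝔸) (α ρ : ℝ) : 𝔸 := Ring.inverse (axDen ζ α ρ)

/-- The product of the kernels `((ζ_h - α_h)² + β_h²)⁻¹` for `h ∈ K` and
`(ζ_h - α_h) ((ζ_h - α_h)² + β_h²)⁻¹` for `h ∉ K`. -/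
def axProd (ζ : Fin n → 𝔸) (K : Finset (Fin n)) (z : Fin n → ℂ) : 𝔸 :=
  ∏ h, (if h ∈ K then axKer (ζ h) (z h).re ((z h).im ^ 2)
    else (ζ h - algebraMap ℝ 𝔸 (z h).re) * axKer (ζ h) (z h).re ((z h).im ^ 2))

end Kernel

/-! ### The Cauchy functional -/

lemma exists_integral_functional {X : Type*} [TopologicalSpace X] [CompactSpace X]
    [MeasurableSpace X] [BorelSpace X] (μ : MeasureTheory.Measure X)
    [MeasureTheory.IsFiniteMeasure μ] (w : C(X, ℂ)) :
    ∃ L : C(X, ℂ) →L[ℂ] ℂ, ∀ k, L k = ∫ x, w x * k x ∂μ := by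
  have hint : ∀ k : C(X, ℂ), MeasureTheory.Integrable (fun x => w x * k x) μ := by
    intro k
    exact (w.continuous.mul k.continuous).integrable_of_hasCompactSupport
      (HasCompactSupport.of_compactSpace _)
  refine ⟨LinearMap.mkContinuous
    { toFun := fun k => ∫ x, w x * k x ∂μ
      map_add' := fun k l => ?_
      map_smul' := fun a k => ?_ } (‖w‖ * μ.real Set.univ) fun k => ?_, fun k => rfl⟩
  · rw [← MeasureTheory.integral_add (hint k) (hint l)]
    simp [mul_add]
  · simp only [ContinuousMap.smul_apply, smul_eq_mul, RingHom.id_apply]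
    rw [← MeasureTheory.integral_const_mul]
    simp [mul_left_comm]
  · refine (MeasureTheory.norm_integral_le_of_norm_le_const (C := ‖w‖ * ‖k‖)
      (Filter.Eventually.of_forall fun x => ?_)).trans_eq (by ring)
    rw [norm_mul]
    exact mul_le_mul (w.norm_coe_le_norm x) (k.norm_coe_le_norm x) (norm_nonneg _) (norm_nonneg _)

/-- The points obtained from `c` by conjugating some of its coordinates. -/
def centers (c : Fin n → ℂ) : Finset (Fin n → ℂ) :=
  Fintype.piFinset fun h => {c h, starRingEnd ℂ (c h)}

lemma conjOn_mem_centers (c : Fin n → ℂ) (N : Finset (Fin n)) : conjOn N c ∈ centers c := by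
  rw [centers, Fintype.mem_piFinset]
  intro h
  by_cases hh : h ∈ N <;> simp [conjOn, hh]

lemma exists_conjOn_of_mem_centers {c p : Fin n → ℂ} (hp : p ∈ centers c) :
    ∃ N, p = conjOn N c := by
  classical
  rw [centers, Fintype.mem_piFinset] at hp
  refine ⟨Finset.univ.filter fun h => p h ≠ c h, funext fun h => ?_⟩
  by_cases hh : p h = c h
  · simp [conjOn, hh]
  · have := hp h
    simp only [Finset.mem_insert, Finset.mem_singleton, hh, false_or] at this
    simpa [conjOn, hh] using this

/-- Centres that differ in the h-th coordinate differ there by conjugation, hence by 2|Im c_h| > 2r;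
the triangle inequality keeps a point of one disc away from the other. -/
lemma centers_separated {c : Fin n → ℂ} {r : ℝ}
    (hsep : ∀ h, (c h).im ≠ 0 → r < |(c h).im|) {p q w : Fin n → ℂ} (hp : p ∈ centers c)
    (hq : q ∈ centers c) {h : Fin n} (hw : dist (w h) (q h) < r) :
    p h = q h ∨ r < dist (w h) (p h) := by
  rw [centers, Fintype.mem_piFinset] at hp hq
  have hp := hp h
  have hq := hq h
  simp only [Finset.mem_insert, Finset.mem_singleton] at hp hq
  by_cases hpq : p h = q h
  · exact Or.inl hpq
  right
  have hd : dist (p h) (q h) = 2 * |(c h).im| ∧ (c h).im ≠ 0 := by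
    constructor
    · rcases hp with hp | hp <;> rcases hq with hq | hq
      · exact absurd (hp.trans hq.symm) hpq
      · rw [hp, hq]; exact Complex.dist_self_conj _
      · rw [hp, hq]; exact Complex.dist_conj_self _
      · exact absurd (hp.trans hq.symm) hpq
    · intro h0
      have := Complex.conj_eq_iff_im.2 h0
      rw [this] at hp hq
      simp only [or_self] at hp hq
      exact hpq (hp.trans hq.symm)
  have h1 := hsep h hd.2
  have h2 := dist_triangle_left (p h) (q h) (w h)
  linarith [hd.1]

/-- The disjoint union of the parameter boxes of the tori around the `centers`. -/
abbrev TorusSpace (c : Fin n → ℂ) : Type :=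
  {p // p ∈ centers c} × {θ : Fin n → ℝ // θ ∈ Set.Icc (0 : Fin n → ℝ) fun _ => 2 * Real.pi}

instance (c : Fin n → ℂ) : CompactSpace (TorusSpace c) := by
  have h1 : CompactSpace {θ : Fin n → ℝ // θ ∈ Set.Icc (0 : Fin n → ℝ) fun _ => 2 * Real.pi} :=
    isCompact_iff_compactSpace.1 isCompact_Icc
  infer_instance

/-- The `h`-th coordinate of a point of the tori around the `centers`. -/
def torusCoord (c : Fin n → ℂ) (r : ℝ) (h : Fin n) : C(TorusSpace c, ℂ) where
  toFun t := torusMap t.1.1 (fun _ => r) t.2.1 h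
  continuous_toFun := by
    have h1 : Continuous fun t : TorusSpace c => t.1.1 h :=
      (continuous_apply h).comp (continuous_subtype_val.comp continuous_fst)
    have h2 : Continuous fun t : TorusSpace c => t.2.1 h :=
      (continuous_apply h).comp (continuous_subtype_val.comp continuous_snd)
    unfold torusMap
    fun_prop

/-- The functional is the sum of the Cauchy integrals over the tori around all the centres. A pole w
near q lies outside some coordinate disc of every other torus, whose integral then vanishes. A
single functional is needed because the components of a stem function are recovered from its values
at all conjugates at once. Centres that coincide, because some c_h are real, are counted once,
`centers` being a `Finset`. -/
theorem exists_cauchy_functional {φ : (Fin n → ℂ) → ℂ} {c : Fin n → ℂ} {r : ℝ} (hr : 0 < r)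
    (hsep : ∀ h, (c h).im ≠ 0 → r < |(c h).im|)
    (hφ : ∀ p ∈ centers c, ContinuousOn φ (Metric.closedBall p r))
    (hd : ∀ p ∈ centers c, ∀ z ∈ Metric.closedBall p r, ∀ h : Fin n,
      DifferentiableAt ℂ (fun t => φ (Function.update z h t)) (z h)) :
    ∃ L : C(TorusSpace c, ℂ) →L[ℂ] ℂ, ∀ q ∈ centers c, ∀ w ∈ Metric.ball q r,
      ∀ k : C(TorusSpace c, ℂ), (∀ t, k t = ∏ h, (torusCoord c r h t - w h)⁻¹) → L k = φ w := by
  classical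
  let B := {θ : Fin n → ℝ // θ ∈ Set.Icc (0 : Fin n → ℝ) fun _ => 2 * Real.pi}
  have hB : CompactSpace B := isCompact_iff_compactSpace.1 isCompact_Icc
  let μ : MeasureTheory.Measure B := MeasureTheory.Measure.comap Subtype.val MeasureTheory.volume
  have hμ : MeasureTheory.IsFiniteMeasure μ := by
    constructor
    rw [MeasureTheory.Measure.comap_apply _ Subtype.val_injective
      (fun s hs => (MeasurableEmbedding.subtype_coe measurableSet_Icc).measurableSet_image.2 hs)
      _ MeasurableSet.univ]
    simp only [Set.image_univ, Subtype.range_coe]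
    exact isCompact_Icc.measure_lt_top
  -- The weight collects the normalisation (2πi)⁻ⁿ, the Jacobian of the torus parametrisation and φ;
  -- only the Cauchy kernel is left as the argument of the functional.
  let wt : {p // p ∈ centers c} → C(B, ℂ) := fun p =>
    { toFun := fun θ => (2 * Real.pi * Complex.I)⁻¹ ^ n *
        ((∏ h, (r * Complex.exp (θ.1 h * Complex.I) * Complex.I)) *
          φ (torusMap p.1 (fun _ => r) θ.1))
      continuous_toFun := by
        refine continuous_const.mul (Continuous.mul (continuous_finsetProd _ fun h _ => ?_) ?_)
        · have h1 : Continuous fun θ : B => θ.1 h :=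
            (continuous_apply h).comp continuous_subtype_val
          exact (continuous_const.mul (Complex.continuous_exp.comp
            ((Complex.continuous_ofReal.comp h1).mul continuous_const))).mul continuous_const
        exact (hφ p.1 p.2).comp_continuous ((continuous_torusMap _ _).comp continuous_subtype_val)
          fun θ => torusMap_mem_closedBall _ hr _ }
  choose L hL using fun p => exists_integral_functional μ (wt p)
  -- Composition with `ι p` restricts a function on the disjoint union to the p-th torus.
  let ι : ∀ p : {p // p ∈ centers c}, C(B, TorusSpace c) := fun p =>
    ⟨fun θ => (p, θ), by fun_prop⟩
  let pre : ∀ p, C(TorusSpace c, ℂ) →L[ℂ] C(B, ℂ) := fun p =>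
    ⟨(ContinuousMap.compRightAlgHom ℂ ℂ (ι p)).toLinearMap, ContinuousMap.continuous_precomp _⟩
  refine ⟨∑ p, (L p).comp (pre p), fun q hq w hw k hk => ?_⟩
  have hterm : ∀ p, L p (pre p k) = if w ∈ Metric.ball p.1 r then φ w else 0 := by
    intro p
    have hne : ∀ h, dist (w h) (p.1 h) ≠ r := by
      intro h
      have h1 : dist (w h) (q h) < r := (dist_le_pi_dist w q h).trans_lt hw
      rcases centers_separated hsep p.2 hq h1 with h2 | h2
      · rw [h2]; exact h1.ne
      · exact h2.ne'
    have h1 := torusIntegral_prod_sub_inv_mul hr (hφ p.1 p.2) (hd p.1 p.2) hne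
    rw [hL]
    have h2 : ∀ θ : B, wt p θ * pre p k θ = (fun θ : Fin n → ℝ => (2 * Real.pi * Complex.I)⁻¹ ^ n *
        ((∏ h, (r * Complex.exp (θ h * Complex.I) * Complex.I)) *
          ((∏ h, (torusMap p.1 (fun _ => r) θ h - w h)⁻¹) *
            φ (torusMap p.1 (fun _ => r) θ)))) θ.1 := by
      intro θ
      have h3 : pre p k θ = ∏ h, (torusMap p.1 (fun _ => r) θ.1 h - w h)⁻¹ := hk (p, θ)
      rw [h3]
      change (2 * Real.pi * Complex.I)⁻¹ ^ n *
        ((∏ h, (r * Complex.exp (θ.1 h * Complex.I) * Complex.I)) *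
          φ (torusMap p.1 (fun _ => r) θ.1)) * _ = _
      ring
    simp only [h2]
    rw [MeasureTheory.integral_subtype_comap measurableSet_Icc (fun θ : Fin n → ℝ =>
      (2 * Real.pi * Complex.I)⁻¹ ^ n *
        ((∏ h, (r * Complex.exp (θ h * Complex.I) * Complex.I)) *
          ((∏ h, (torusMap p.1 (fun _ => r) θ h - w h)⁻¹) *
            φ (torusMap p.1 (fun _ => r) θ)))), MeasureTheory.integral_const_mul]
    have h4 := h1
    unfold torusIntegral at h4
    simp only [smul_eq_mul] at h4
    rw [h4]
    split_ifs
    · rw [← mul_assoc, ← mul_pow, inv_mul_cancel₀, one_pow, one_mul]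
      simp [Real.pi_ne_zero]
    · simp
  simp only [_root_.sum_apply, ContinuousLinearMap.comp_apply, hterm]
  rw [Finset.sum_eq_single ⟨q, hq⟩]
  · rw [if_pos hw]
  · intro p _ hp
    rw [if_neg]
    intro hwp
    refine hp (Subtype.ext (funext fun h => ?_))
    have h1 : dist (w h) (q h) < r := (dist_le_pi_dist w q h).trans_lt hw
    have h2 : dist (w h) (p.1 h) < r := (dist_le_pi_dist w p.1 h).trans_lt hwp
    rcases centers_separated hsep p.2 hq h1 with h3 | h3
    · exact h3
    · exact absurd h2 h3.not_gt
  · simp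

/-! ### Local representation of stem functions -/

lemma ringInverse_apply {T : Type*} [TopologicalSpace T] [CompactSpace T] {f : C(T, ℂ)}
    (hf : IsUnit f) (t : T) : Ring.inverse f t = (f t)⁻¹ := by
  have h1 := congrArg (fun g : C(T, ℂ) => g t) (Ring.mul_inverse_cancel f hf)
  exact eq_inv_of_mul_eq_one_right h1

lemma prod_add_smul_eq_sum {𝔸 : Type*} [NormedCommRing 𝔸] [NormedAlgebra ℂ 𝔸]
    (a b : Fin n → 𝔸) (s : Fin n → ℂ) :
    ∏ h, (s h • b h + a h) = ∑ K : Finset (Fin n), (∏ h ∈ K, s h) •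
      ∏ h, (if h ∈ K then b h else a h) := by
  rw [Finset.prod_add, Finset.powerset_univ]
  refine Finset.sum_congr rfl fun K _ => ?_
  rw [Finset.prod_ite, Finset.prod_smul, smul_mul_assoc]
  congr 3 <;> ext <;> simp

lemma axDen_torusCoord_apply (c : Fin n → ℂ) (r : ℝ) (h : Fin n) (w : ℂ) (t : TorusSpace c) :
    axDen (torusCoord c r h) w.re (w.im ^ 2) t =
      (torusCoord c r h t - w) * (torusCoord c r h t - starRingEnd ℂ w) := by
  have h1 : axDen (torusCoord c r h) w.re (w.im ^ 2) t =
      (torusCoord c r h t - (w.re : ℂ)) ^ 2 + ((w.im ^ 2 : ℝ) : ℂ) := rfl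
  have h2 : w = w.re + w.im * Complex.I := (Complex.re_add_im w).symm
  have h3 : starRingEnd ℂ w = w.re - w.im * Complex.I := by
    apply Complex.ext <;> simp
  rw [h1, h3]
  nth_rewrite 3 [h2]
  push_cast
  linear_combination ((w.im : ℂ) ^ 2) * Complex.I_sq

lemma dist_conjOn (N : Finset (Fin n)) (z c : Fin n → ℂ) : dist (conjOn N z) (conjOn N c) = dist z c := by
  have h1 : ∀ z c : Fin n → ℂ, dist (conjOn N z) (conjOn N c) ≤ dist z c := by
    intro z c
    rw [dist_pi_le_iff dist_nonneg]
    intro h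
    by_cases hh : h ∈ N
    · simp only [conjOn, hh, if_true, Complex.dist_conj_conj]
      exact dist_le_pi_dist z c h
    · simp only [conjOn, hh, if_false]
      exact dist_le_pi_dist z c h
  have h2 : ∀ z : Fin n → ℂ, conjOn N (conjOn N z) = z := by
    intro z
    funext h
    by_cases hh : h ∈ N <;> simp [conjOn, hh]
  refine le_antisymm (h1 z c) ?_
  have := h1 (conjOn N z) (conjOn N c)
  rwa [h2, h2] at this

lemma torusCoord_ne {c : Fin n → ℂ} {r : ℝ} (hr : 0 < r)
    (hsep : ∀ h, (c h).im ≠ 0 → r < |(c h).im|) {q w : Fin n → ℂ} (hq : q ∈ centers c)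
    (hw : w ∈ Metric.ball q r) (h : Fin n) (t : TorusSpace c) :
    torusCoord c r h t - w h ≠ 0 := by
  intro h0
  have h1 : dist (torusMap t.1.1 (fun _ => r) t.2.1 h) (t.1.1 h) = r := dist_torusMap _ hr _ _
  have h2 : torusMap t.1.1 (fun _ => r) t.2.1 h = w h := sub_eq_zero.1 h0
  rw [h2] at h1
  have h3 : dist (w h) (q h) < r := (dist_le_pi_dist w q h).trans_lt hw
  rcases centers_separated hsep t.1.2 hq h3 with h4 | h4
  · rw [h4] at h1; exact h3.ne h1
  · exact h4.ne' h1

lemma isUnit_axDen_torusCoord {c : Fin n → ℂ} {r : ℝ} (hr : 0 < r)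
    (hsep : ∀ h, (c h).im ≠ 0 → r < |(c h).im|) {z : Fin n → ℂ} (hz : z ∈ Metric.ball c r)
    (h : Fin n) : IsUnit (axDen (torusCoord c r h) (z h).re ((z h).im ^ 2)) := by
  rw [ContinuousMap.isUnit_iff_forall_ne_zero]
  intro t
  rw [axDen_torusCoord_apply]
  have h1 : ∀ N : Finset (Fin n), torusCoord c r h t - conjOn N z h ≠ 0 := fun N =>
    torusCoord_ne hr hsep (conjOn_mem_centers c N)
      (by rw [Metric.mem_ball, dist_conjOn]; exact hz) h t
  refine mul_ne_zero ?_ ?_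
  · simpa [conjOn] using h1 ∅
  · simpa [conjOn] using h1 Finset.univ

/-- Conjugating z_h only changes the sign of β_h in 1/(ζ - z_h) = (ζ - α)k + iβk, where k = 1/((ζ -
α)² + β²) is unaffected. Expanding the product over h turns the Cauchy formula at each conjugate of
z into a signed sum over K, and Fourier inversion compares the terms. -/
theorem stem_component_eq {D : Set (Fin n → ℂ)} (hD : ConjInvariant D)
    {G : (Fin n → ℂ) → StemVal n} (hG : IsStem D G) {c : Fin n → ℂ} {r : ℝ} (hr : 0 < r)
    (hsep : ∀ h, (c h).im ≠ 0 → r < |(c h).im|) (hcD : Metric.closedBall c r ⊆ D)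
    (lam : ℍ[ℝ] →L[ℝ] ℝ) (hcont : ContinuousOn (stemPhi lam G) D)
    (hd : ∀ z ∈ D, ∀ h : Fin n,
      DifferentiableAt ℂ (fun t => stemPhi lam G (Function.update z h t)) (z h)) :
    ∃ L : C(TorusSpace c, ℂ) →L[ℝ] ℝ, ∀ z ∈ Metric.ball c r, ∀ K,
      lam (G z K) = (∏ h ∈ K, (z h).im) * L (axProd (torusCoord c r) K z) := by
  have hsub : ∀ p ∈ centers c, Metric.closedBall p r ⊆ D := by
    intro p hp z hz
    obtain ⟨N, rfl⟩ := exists_conjOn_of_mem_centers hp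
    have h1 : conjOn N (conjOn N z) = z := by
      funext h
      by_cases hh : h ∈ N <;> simp [conjOn, hh]
    rw [← h1]
    refine IsStem.conjOn_mem hD (hcD ?_) N
    rw [Metric.mem_closedBall, ← dist_conjOn N, h1]
    exact hz
  obtain ⟨L, hL⟩ := exists_cauchy_functional (φ := stemPhi lam G) hr hsep
    (fun p hp => hcont.mono (hsub p hp)) (fun p hp z hz => hd z (hsub p hp hz))
  -- The Cauchy functional is complex valued, but the component it must equal is real, so its real
  -- part suffices.
  refine ⟨Complex.reCLM.comp (L.restrictScalars ℝ), fun z hz K => ?_⟩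
  have hzD : z ∈ D := hcD (Metric.ball_subset_closedBall hz)
  have hu := isUnit_axDen_torusCoord hr hsep hz
  let b : Fin n → C(TorusSpace c, ℂ) := fun h =>
    axKer (torusCoord c r h) (z h).re ((z h).im ^ 2)
  let a : Fin n → C(TorusSpace c, ℂ) := fun h =>
    (torusCoord c r h - algebraMap ℝ _ (z h).re) * axKer (torusCoord c r h) (z h).re ((z h).im ^ 2)
  have key : (fun K : Finset (Fin n) => Complex.I ^ K.card * (lam (G z K) : ℂ)) =
      fun K => Complex.I ^ K.card * ((∏ h ∈ K, (z h).im : ℝ) *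
        L (axProd (torusCoord c r) K z)) := by
    refine eq_of_sum_prod_sgnOn_mul fun N => ?_
    rw [← stemPhi_conjOn hD hG lam hzD N]
    rw [← hL _ (conjOn_mem_centers c N) (conjOn N z) (by rwa [Metric.mem_ball, dist_conjOn])
      (∏ h, ((Complex.I * (sgnOn N h * (z h).im)) • b h + a h)) ?_]
    · rw [prod_add_smul_eq_sum, map_sum]
      refine Finset.sum_congr rfl fun M _ => ?_
      rw [map_smul, smul_eq_mul, Finset.prod_mul_distrib, Finset.prod_const,
        Finset.prod_mul_distrib]
      push_cast
      change _ * L (axProd (torusCoord c r) M z) = _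
      ring
    · intro t
      rw [ContinuousMap.prod_apply]
      refine Finset.prod_congr rfl fun h _ => ?_
      have h1 : b h t = (axDen (torusCoord c r h) (z h).re ((z h).im ^ 2) t)⁻¹ :=
        ringInverse_apply (hu h) t
      have h2 : a h t = (torusCoord c r h t - ((z h).re : ℂ)) * b h t := rfl
      rw [ContinuousMap.add_apply, ContinuousMap.smul_apply, h2, h1, axDen_torusCoord_apply,
        smul_eq_mul]
      have hne : ∀ N : Finset (Fin n), torusCoord c r h t - conjOn N z h ≠ 0 := fun N =>
        torusCoord_ne hr hsep (conjOn_mem_centers c N)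
          (by rw [Metric.mem_ball, dist_conjOn]; exact hz) h t
      have h3 : torusCoord c r h t - z h ≠ 0 := by simpa [conjOn] using hne ∅
      have h4 : torusCoord c r h t - starRingEnd ℂ (z h) ≠ 0 := by
        simpa [conjOn] using hne Finset.univ
      have h5 : z h = (z h).re + (z h).im * Complex.I := (Complex.re_add_im _).symm
      have h6 : starRingEnd ℂ (z h) = (z h).re - (z h).im * Complex.I := by
        apply Complex.ext <;> simp
      by_cases hh : h ∈ N
      · have h7 : conjOn N z h = starRingEnd ℂ (z h) := by simp [conjOn, hh]
        rw [h7]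
        field_simp
        simp only [sgnOn, hh, if_true]
        push_cast
        linear_combination h5
      · have h7 : conjOn N z h = z h := by simp [conjOn, hh]
        rw [h7]
        field_simp
        simp only [sgnOn, hh, if_false]
        push_cast
        linear_combination h6
  have h1 := mul_left_cancel₀ (pow_ne_zero _ Complex.I_ne_zero) (congrFun key K)
  have h2 := congrArg Complex.re h1
  rw [Complex.ofReal_re, Complex.re_ofReal_mul] at h2
  exact h2

theorem exists_local_representation {D : Set (Fin n → ℂ)} (hDo : IsOpen D)
    (hD : ConjInvariant D) {G : (Fin n → ℂ) → StemVal n} (hG : IsStem D G)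
    (hcont : ∀ lam, ContinuousOn (stemPhi lam G) D)
    (hd : ∀ lam, ∀ z ∈ D, ∀ h : Fin n,
      DifferentiableAt ℂ (fun t => stemPhi lam G (Function.update z h t)) (z h))
    {c : Fin n → ℂ} (hc : c ∈ D) :
    ∃ (r : ℝ) (L : C(TorusSpace c, ℂ) →L[ℝ] ℍ[ℝ]), 0 < r ∧ Metric.ball c r ⊆ D ∧
      ∀ z ∈ Metric.ball c r,
      (∀ h, IsUnit (axDen (torusCoord c r h) (z h).re ((z h).im ^ 2))) ∧
      ∀ K, G z K = (∏ h ∈ K, (z h).im) • L (axProd (torusCoord c r) K z) := by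
  -- The radius stays below every nonzero |Im c_h|, so that discs around distinct conjugates are
  -- disjoint; real coordinates impose no condition.
  obtain ⟨r, hr, hrD, hsep⟩ : ∃ r : ℝ, 0 < r ∧ Metric.closedBall c r ⊆ D ∧
      ∀ h, (c h).im ≠ 0 → r < |(c h).im| := by
    obtain ⟨s, hs, hsD⟩ := Metric.nhds_basis_closedBall.mem_iff.1 (hDo.mem_nhds hc)
    have h1 : ∀ᶠ r in nhdsWithin (0 : ℝ) (Set.Ioi 0), ∀ h, (c h).im ≠ 0 → r < |(c h).im| := by
      rw [Filter.eventually_all]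
      intro h
      by_cases h0 : (c h).im = 0
      · simp [h0]
      · have := (Iio_mem_nhds (abs_pos.2 h0))
        filter_upwards [nhdsWithin_le_nhds this] with r hr _ using hr
    have h2 : ∀ᶠ r in nhdsWithin (0 : ℝ) (Set.Ioi 0), r < s :=
      nhdsWithin_le_nhds (Iio_mem_nhds hs)
    obtain ⟨r, ⟨h3, h4⟩, h5⟩ := ((h1.and h2).and self_mem_nhdsWithin).exists
    exact ⟨r, h5, (Metric.closedBall_subset_closedBall h4.le).trans hsD, h3⟩
  choose L hL using fun lam => stem_component_eq hD hG hr hsep hrD lam (hcont lam) (hd lam)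
  -- The functionals for the four real coordinates are assembled into one with values in ℍ.
  refine ⟨r, (L reL).smulRight 1 + (L imIL).smulRight qi + (L imJL).smulRight qj
    + (L imKL).smulRight qk, hr, Metric.ball_subset_closedBall.trans hrD, fun z hz =>
      ⟨isUnit_axDen_torusCoord hr hsep hz, fun K => ?_⟩⟩
  have h1 := hL reL z hz K
  have h2 := hL imIL z hz K
  have h3 := hL imJL z hz K
  have h4 := hL imKL z hz K
  simp only [reL_apply, imIL_apply, imJL_apply, imKL_apply] at h1 h2 h3 h4
  simp only [_root_.add_apply, ContinuousLinearMap.smulRight_apply]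
  ext
  · simp [h1]
  · simp [h2]
  · simp [h3]
  · simp [h4]

/-! ### Calculus of the kernels -/

lemma norm_im_sq (q : ℍ[ℝ]) : ‖q.im‖ ^ 2 = q.imI ^ 2 + q.imJ ^ 2 + q.imK ^ 2 := by
  rw [pow_two, ← Quaternion.normSq_eq_norm_mul_self, Quaternion.normSq_def']
  simp

/-- The inner product of the imaginary parts. -/
def imDot (q v : ℍ[ℝ]) : ℝ := q.imI * v.imI + q.imJ * v.imJ + q.imK * v.imK

section Kernel

variable {𝔸 : Type*} [NormedCommRing 𝔸] [NormedAlgebra ℝ 𝔸]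

/-- `axDen` as a function of a quaternion. -/
def qDen (ζ : 𝔸) (q : ℍ[ℝ]) : 𝔸 := axDen ζ q.re (‖q.im‖ ^ 2)

/-- `axKer` as a function of a quaternion. -/
def qKer (ζ : 𝔸) (q : ℍ[ℝ]) : 𝔸 := axKer ζ q.re (‖q.im‖ ^ 2)

/-- The derivative of `-qDen` in the direction `v`. -/
def qNum (ζ : 𝔸) (v q : ℍ[ℝ]) : 𝔸 :=
  2 * algebraMap ℝ 𝔸 v.re * (ζ - algebraMap ℝ 𝔸 q.re) - 2 * algebraMap ℝ 𝔸 (imDot q v)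

lemma qKer_mul_qDen {ζ : 𝔸} {q : ℍ[ℝ]} (hq : IsUnit (qDen ζ q)) : qKer ζ q * qDen ζ q = 1 :=
  Ring.inverse_mul_cancel _ hq

lemma hasDerivAt_algebraMap {f : ℝ → ℝ} {f' t : ℝ} (hf : HasDerivAt f f' t) :
    HasDerivAt (fun t => algebraMap ℝ 𝔸 (f t)) (algebraMap ℝ 𝔸 f') t :=
  (algebraMapCLM ℝ 𝔸).hasFDerivAt.comp_hasDerivAt t hf

lemma hasDerivAt_of_eq {E : Type*} [NormedAddCommGroup E] [NormedSpace ℝ E] {f g : ℝ → E}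
    {f' g' : E} {t : ℝ} (hf : HasDerivAt f f' t) (hfg : ∀ s, g s = f s) (h' : g' = f') :
    HasDerivAt g g' t := by
  rw [funext hfg, h']
  exact hf

lemma hasDerivAt_add_mul (a b : ℝ) : HasDerivAt (fun t : ℝ => a + t * b) b 0 := by
  simpa using ((hasDerivAt_id (0 : ℝ)).mul_const b).const_add a

lemma hasDerivAt_sub_algebraMap_re (ζ : 𝔸) (q v : ℍ[ℝ]) :
    HasDerivAt (fun t : ℝ => ζ - algebraMap ℝ 𝔸 (q + t • v).re) (-algebraMap ℝ 𝔸 v.re) 0 := by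
  have h1 := (hasDerivAt_algebraMap (𝔸 := 𝔸) (hasDerivAt_add_mul q.re v.re)).const_sub ζ
  simpa using h1

lemma hasDerivAt_qDen (ζ : 𝔸) (q v : ℍ[ℝ]) :
    HasDerivAt (fun t : ℝ => qDen ζ (q + t • v)) (-qNum ζ v q) 0 := by
  have h1 := (hasDerivAt_sub_algebraMap_re ζ q v).pow 2
  have h2 := hasDerivAt_algebraMap (𝔸 := 𝔸) ((((hasDerivAt_add_mul q.imI v.imI).pow 2).add
    ((hasDerivAt_add_mul q.imJ v.imJ).pow 2)).add ((hasDerivAt_add_mul q.imK v.imK).pow 2))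
  have h3 := h1.add h2
  refine hasDerivAt_of_eq h3 (fun t => ?_) ?_
  · simp only [qDen, axDen, norm_im_sq]
    simp
  · have h4 : algebraMap ℝ 𝔸 2 = 2 := map_ofNat _ 2
    simp [qNum, imDot, h4]
    ring

lemma hasDerivAt_qKer [CompleteSpace 𝔸] {ζ : 𝔸} {q : ℍ[ℝ]} (hq : IsUnit (qDen ζ q)) (v : ℍ[ℝ]) :
    HasDerivAt (fun t : ℝ => qKer ζ (q + t • v)) (qNum ζ v q * qKer ζ q ^ 2) 0 := by
  obtain ⟨u, hu⟩ := hq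
  have h1 := hasFDerivAt_ringInverse (𝕜 := ℝ) u
  have h2 := hasDerivAt_qDen ζ q v
  have h0 : qDen ζ (q + (0 : ℝ) • v) = u := by rw [zero_smul, add_zero, hu]
  rw [← h0] at h1
  have h3 := h1.comp_hasDerivAt (0 : ℝ) h2
  have h4 : qKer ζ q = ↑u⁻¹ := by
    change Ring.inverse (qDen ζ q) = _
    rw [← hu, Ring.inverse_unit]
  refine hasDerivAt_of_eq h3 (fun t => rfl) ?_
  rw [h4]
  simp
  ring

lemma hasDerivAt_qNum (ζ : 𝔸) (q v : ℍ[ℝ]) :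
    HasDerivAt (fun t : ℝ => qNum ζ v (q + t • v)) (-2 * algebraMap ℝ 𝔸 (v.re ^ 2 + imDot v v)) 0 := by
  have h1 := (hasDerivAt_sub_algebraMap_re ζ q v).const_mul (2 * algebraMap ℝ 𝔸 v.re)
  have h2 := (hasDerivAt_algebraMap (𝔸 := 𝔸) (hasDerivAt_add_mul (imDot q v) (imDot v v))).const_mul 2
  refine hasDerivAt_of_eq (h1.sub h2) (fun t => ?_) ?_
  · have h3 : imDot (q + t • v) v = imDot q v + t * imDot v v := by
      simp [imDot]
      ring
    simp only [Pi.sub_apply, qNum, h3]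
  · rw [map_add, map_pow]
    ring

/-- The second derivative of `qKer` in the direction `v`. -/
def qKerSnd (ζ : 𝔸) (v q : ℍ[ℝ]) : 𝔸 :=
  -2 * algebraMap ℝ 𝔸 (v.re ^ 2 + imDot v v) * qKer ζ q ^ 2 +
    2 * qNum ζ v q ^ 2 * qKer ζ q ^ 3

lemma hasDerivAt_qNum_mul_qKer_sq [CompleteSpace 𝔸] {ζ : 𝔸} {q : ℍ[ℝ]} (hq : IsUnit (qDen ζ q)) (v : ℍ[ℝ]) :
    HasDerivAt (fun t : ℝ => qNum ζ v (q + t • v) * qKer ζ (q + t • v) ^ 2) (qKerSnd ζ v q) 0 := by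
  refine hasDerivAt_of_eq ((hasDerivAt_qNum ζ q v).mul ((hasDerivAt_qKer hq v).pow 2))
    (fun t => rfl) ?_
  unfold qKerSnd
  simp
  ring

/-- The kernel is formally the inverse squared distance in ℝ⁴, which is harmonic. The four terms
-2k² add up to -8k², while the squares of `qNum` add up to four times the denominator and contribute
8k². -/
lemma sum_qKerSnd {ζ : 𝔸} {q : ℍ[ℝ]} (hq : IsUnit (qDen ζ q)) :
    qKerSnd ζ 1 q + qKerSnd ζ qi q + qKerSnd ζ qj q + qKerSnd ζ qk q = 0 := by
  have h1 := qKer_mul_qDen hq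
  have h2 : qDen ζ q = (ζ - algebraMap ℝ 𝔸 q.re) ^ 2 + (algebraMap ℝ 𝔸 q.imI ^ 2 +
      algebraMap ℝ 𝔸 q.imJ ^ 2 + algebraMap ℝ 𝔸 q.imK ^ 2) := by
    unfold qDen axDen
    rw [norm_im_sq]
    simp
  rw [h2] at h1
  unfold qKerSnd qNum imDot
  simp
  linear_combination (8 * qKer ζ q ^ 2) * h1

/-- The first derivative of `(ζ - re q) qKer` in the direction `v`. -/
def qCoKerFst (ζ : 𝔸) (v q : ℍ[ℝ]) : 𝔸 :=
  -algebraMap ℝ 𝔸 v.re * qKer ζ q + (ζ - algebraMap ℝ 𝔸 q.re) * (qNum ζ v q * qKer ζ q ^ 2)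

/-- The second derivative of `(ζ - re q) qKer` in the direction `v`. -/
def qCoKerSnd (ζ : 𝔸) (v q : ℍ[ℝ]) : 𝔸 :=
  -2 * algebraMap ℝ 𝔸 v.re * (qNum ζ v q * qKer ζ q ^ 2) +
    (ζ - algebraMap ℝ 𝔸 q.re) * qKerSnd ζ v q

lemma hasDerivAt_qCoKer [CompleteSpace 𝔸] {ζ : 𝔸} {q : ℍ[ℝ]} (hq : IsUnit (qDen ζ q)) (v : ℍ[ℝ]) :
    HasDerivAt (fun t : ℝ => (ζ - algebraMap ℝ 𝔸 (q + t • v).re) * qKer ζ (q + t • v))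
      (qCoKerFst ζ v q) 0 := by
  refine hasDerivAt_of_eq ((hasDerivAt_sub_algebraMap_re ζ q v).mul (hasDerivAt_qKer hq v))
    (fun t => rfl) ?_
  unfold qCoKerFst
  simp

lemma hasDerivAt_qCoKerFst [CompleteSpace 𝔸] {ζ : 𝔸} {q : ℍ[ℝ]} (hq : IsUnit (qDen ζ q)) (v : ℍ[ℝ]) :
    HasDerivAt (fun t : ℝ => qCoKerFst ζ v (q + t • v)) (qCoKerSnd ζ v q) 0 := by
  refine hasDerivAt_of_eq (((hasDerivAt_qKer hq v).const_mul (-algebraMap ℝ 𝔸 v.re)).add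
    ((hasDerivAt_sub_algebraMap_re ζ q v).mul (hasDerivAt_qNum_mul_qKer_sq hq v)))
    (fun t => rfl) ?_
  unfold qCoKerSnd
  simp
  ring

/-- Leibniz rule: k is harmonic and ζ - re q is affine, so only the cross term in the real direction
survives. -/
lemma sum_qCoKerSnd {ζ : 𝔸} {q : ℍ[ℝ]} (hq : IsUnit (qDen ζ q)) :
    qCoKerSnd ζ 1 q + qCoKerSnd ζ qi q + qCoKerSnd ζ qj q + qCoKerSnd ζ qk q =
      -2 * (qNum ζ 1 q * qKer ζ q ^ 2) := by
  have h1 := sum_qKerSnd hq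
  unfold qCoKerSnd
  simp
  linear_combination (ζ - algebraMap ℝ 𝔸 q.re) * h1

/-! ### Functions represented by the kernels -/

lemma lineDeriv_eq_of_eqOn {p : ℍ[ℝ] → ℍ[ℝ]} {M : ℍ[ℝ] → 𝔸} {M' : 𝔸} (Λ : 𝔸 →L[ℝ] ℍ[ℝ])
    {U : Set ℍ[ℝ]} (hU : IsOpen U) (hp : ∀ q ∈ U, p q = Λ (M q)) {q v : ℍ[ℝ]} (hq : q ∈ U)
    (hM : HasDerivAt (fun t : ℝ => M (q + t • v)) M' 0) : lineDeriv ℝ p q v = Λ M' := by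
  have h1 : HasDerivAt (fun t : ℝ => Λ (M (q + t • v))) (Λ M') 0 :=
    Λ.hasFDerivAt.comp_hasDerivAt (0 : ℝ) hM
  have h2 : (fun t : ℝ => p (q + t • v)) =ᶠ[nhds 0] fun t => Λ (M (q + t • v)) := by
    have hc : Filter.Tendsto (fun t : ℝ => q + t • v) (nhds 0) (nhds q) := by
      have : Continuous fun t : ℝ => q + t • v := by fun_prop
      simpa using this.tendsto 0
    filter_upwards [hc (hU.mem_nhds hq)] with t ht using hp _ ht
  exact (h1.congr_of_eventuallyEq h2).deriv

lemma lineDeriv_lineDeriv_eq_of_eqOn {p : ℍ[ℝ] → ℍ[ℝ]} {M M' : ℍ[ℝ] → 𝔸} {M'' : 𝔸}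
    (Λ : 𝔸 →L[ℝ] ℍ[ℝ]) {U : Set ℍ[ℝ]} (hU : IsOpen U) (hp : ∀ q ∈ U, p q = Λ (M q))
    {q v : ℍ[ℝ]} (hq : q ∈ U)
    (hM : ∀ q ∈ U, HasDerivAt (fun t : ℝ => M (q + t • v)) (M' q) 0)
    (hM' : HasDerivAt (fun t : ℝ => M' (q + t • v)) M'' 0) :
    lineDeriv ℝ (fun q => lineDeriv ℝ p q v) q v = Λ M'' :=
  lineDeriv_eq_of_eqOn Λ hU (fun q hq => lineDeriv_eq_of_eqOn Λ hU hp hq (hM q hq)) hq hM'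

end Kernel

lemma update_add_smul_single (x : Fin n → ℍ[ℝ]) (h : Fin n) (q v : ℍ[ℝ]) (t : ℝ) :
    Function.update x h q + t • (Pi.single h v : Fin n → ℍ[ℝ]) =
      Function.update x h (q + t • v) := by
  funext k
  by_cases hk : k = h
  · subst hk; simp
  · simp [hk]

lemma partialDir_update (h : Fin n) (v : ℍ[ℝ]) (g : (Fin n → ℍ[ℝ]) → ℍ[ℝ]) (x : Fin n → ℍ[ℝ])
    (q : ℍ[ℝ]) : partialDir h v g (Function.update x h q) =
      lineDeriv ℝ (fun q => g (Function.update x h q)) q v := by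
  unfold partialDir lineDeriv
  simp only [update_add_smul_single]

lemma partialDir_eq_lineDeriv (h : Fin n) (v : ℍ[ℝ]) (g : (Fin n → ℍ[ℝ]) → ℍ[ℝ])
    (x : Fin n → ℍ[ℝ]) : partialDir h v g x =
      lineDeriv ℝ (fun q => g (Function.update x h q)) (x h) v := by
  rw [← partialDir_update, Function.update_eq_self]

lemma partialDir_partialDir_eq_lineDeriv (h : Fin n) (v : ℍ[ℝ]) (g : (Fin n → ℍ[ℝ]) → ℍ[ℝ])
    (x : Fin n → ℍ[ℝ]) : partialDir h v (partialDir h v g) x =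
      lineDeriv ℝ (fun q => lineDeriv ℝ (fun q => g (Function.update x h q)) q v) (x h) v := by
  rw [partialDir_eq_lineDeriv]
  simp only [partialDir_update]

lemma continuous_slicePart : Continuous (slicePart (n := n)) := by
  refine continuous_pi fun h => ?_
  have h1 : Continuous fun x : Fin n → ℍ[ℝ] => (x h).re :=
    Quaternion.continuous_re.comp (continuous_apply h)
  have h2 : Continuous fun x : Fin n → ℍ[ℝ] => ‖(x h).im‖ :=
    (Quaternion.continuous_im.comp (continuous_apply h)).norm
  have h3 : (fun x : Fin n → ℍ[ℝ] => slicePart x h) =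
      fun x => ((x h).re : ℂ) + (‖(x h).im‖ : ℂ) * Complex.I := by
    funext x
    apply Complex.ext <;> simp [slicePart]
  rw [h3]
  fun_prop

section Representation

variable {𝔸 : Type*} [NormedCommRing 𝔸] [NormedAlgebra ℝ 𝔸]
  {ζ : Fin n → 𝔸} {L : 𝔸 →L[ℝ] ℍ[ℝ]} {V : Set (Fin n → ℂ)}
  {A : Finset (Fin n) → (Fin n → ℍ[ℝ]) → ℍ[ℝ]}

/-- The factors of `axProd` other than the `h`-th one. -/
def axRest (ζ : Fin n → 𝔸) (K : Finset (Fin n)) (h : Fin n) (z : Fin n → ℂ) : 𝔸 :=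
  ∏ j ∈ Finset.univ.erase h, (if j ∈ K then axKer (ζ j) (z j).re ((z j).im ^ 2)
    else (ζ j - algebraMap ℝ 𝔸 (z j).re) * axKer (ζ j) (z j).re ((z j).im ^ 2))

lemma axProd_update (ζ : Fin n → 𝔸) (K : Finset (Fin n)) (h : Fin n) (x : Fin n → ℍ[ℝ])
    (q : ℍ[ℝ]) : axProd ζ K (slicePart (Function.update x h q)) =
      axRest ζ K h (slicePart x) *
        if h ∈ K then qKer (ζ h) q else (ζ h - algebraMap ℝ 𝔸 q.re) * qKer (ζ h) q := by
  unfold axProd axRest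
  rw [← Finset.prod_erase_mul _ _ (Finset.mem_univ h)]
  congr 1
  · refine Finset.prod_congr rfl fun j hj => ?_
    have hj' := Finset.ne_of_mem_erase hj
    simp [slicePart, Function.update_of_ne hj']
  · simp [slicePart, qKer]

lemma axRest_insert (ζ : Fin n → 𝔸) (K : Finset (Fin n)) (h : Fin n) (z : Fin n → ℂ) :
    axRest ζ (insert h K) h z = axRest ζ K h z := by
  unfold axRest
  refine Finset.prod_congr rfl fun j hj => ?_
  have hj' := Finset.ne_of_mem_erase hj
  simp [Finset.mem_insert, hj']

lemma isOpen_update_preimage (hVo : IsOpen V) (x : Fin n → ℍ[ℝ]) (h : Fin n) :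
    IsOpen {q | slicePart (Function.update x h q) ∈ V} :=
  hVo.preimage (continuous_slicePart.comp (continuous_const.update h continuous_id))

lemma isUnit_qDen_of_mem (hV : ∀ z ∈ V, ∀ h, IsUnit (axDen (ζ h) (z h).re ((z h).im ^ 2)))
    {x : Fin n → ℍ[ℝ]} {h : Fin n} {q : ℍ[ℝ]} (hq : slicePart (Function.update x h q) ∈ V) :
    IsUnit (qDen (ζ h) q) := by
  have h1 := hV _ hq h
  simpa [slicePart, qDen] using h1

theorem partialDir_of_mem [CompleteSpace 𝔸] (hVo : IsOpen V)
    (hV : ∀ z ∈ V, ∀ h, IsUnit (axDen (ζ h) (z h).re ((z h).im ^ 2)))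
    (hA : ∀ x, slicePart x ∈ V → ∀ K, A K x = L (axProd ζ K (slicePart x)))
    {x : Fin n → ℍ[ℝ]} (hx : slicePart x ∈ V) {h : Fin n} {K : Finset (Fin n)} (hK : h ∈ K)
    (v : ℍ[ℝ]) : partialDir h v (A K) x =
      L (axRest ζ K h (slicePart x) * (qNum (ζ h) v (x h) * qKer (ζ h) (x h) ^ 2)) := by
  have hx' : x h ∈ {q | slicePart (Function.update x h q) ∈ V} := by simpa using hx
  rw [partialDir_eq_lineDeriv]
  refine lineDeriv_eq_of_eqOn (M := qKer (ζ h))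
    (L.comp (ContinuousLinearMap.mul ℝ 𝔸 (axRest ζ K h (slicePart x))))
    (isOpen_update_preimage hVo x h) (fun q hq => ?_) hx'
    (hasDerivAt_qKer (isUnit_qDen_of_mem hV hx') v)
  rw [hA _ hq, axProd_update, if_pos hK]
  rfl

theorem lapl_of_mem [CompleteSpace 𝔸] (hVo : IsOpen V)
    (hV : ∀ z ∈ V, ∀ h, IsUnit (axDen (ζ h) (z h).re ((z h).im ^ 2)))
    (hA : ∀ x, slicePart x ∈ V → ∀ K, A K x = L (axProd ζ K (slicePart x)))
    {x : Fin n → ℍ[ℝ]} (hx : slicePart x ∈ V) {h : Fin n} {K : Finset (Fin n)} (hK : h ∈ K) :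
    lapl h (A K) x = 0 := by
  have hx' : x h ∈ {q | slicePart (Function.update x h q) ∈ V} := by simpa using hx
  have h1 : ∀ v, partialDir h v (partialDir h v (A K)) x =
      L.comp (ContinuousLinearMap.mul ℝ 𝔸 (axRest ζ K h (slicePart x)))
        (qKerSnd (ζ h) v (x h)) := by
    intro v
    rw [partialDir_partialDir_eq_lineDeriv]
    refine lineDeriv_lineDeriv_eq_of_eqOn (M := qKer (ζ h)) _
      (isOpen_update_preimage hVo x h) (fun q hq => ?_) hx'
      (fun q hq => hasDerivAt_qKer (isUnit_qDen_of_mem hV hq) v)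
      (hasDerivAt_qNum_mul_qKer_sq (isUnit_qDen_of_mem hV hx') v)
    rw [hA _ hq, axProd_update, if_pos hK]
    rfl
  unfold lapl
  rw [h1, h1, h1, h1, ← map_add, ← map_add, ← map_add,
    sum_qKerSnd (isUnit_qDen_of_mem hV hx'), map_zero]

/-- The products for K and for `insert h K` differ in the h-th factor only, (ζ - α)k against k, so
the one-variable identity for these factors relates the two components. -/
theorem lapl_of_notMem [CompleteSpace 𝔸] (hVo : IsOpen V)
    (hV : ∀ z ∈ V, ∀ h, IsUnit (axDen (ζ h) (z h).re ((z h).im ^ 2)))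
    (hA : ∀ x, slicePart x ∈ V → ∀ K, A K x = L (axProd ζ K (slicePart x)))
    {x : Fin n → ℍ[ℝ]} (hx : slicePart x ∈ V) {h : Fin n} {K : Finset (Fin n)} (hK : h ∉ K) :
    lapl h (A K) x = (-2 : ℝ) • partialDir h 1 (A (insert h K)) x := by
  have hx' : x h ∈ {q | slicePart (Function.update x h q) ∈ V} := by simpa using hx
  have h1 : ∀ v, partialDir h v (partialDir h v (A K)) x =
      L.comp (ContinuousLinearMap.mul ℝ 𝔸 (axRest ζ K h (slicePart x)))
        (qCoKerSnd (ζ h) v (x h)) := by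
    intro v
    rw [partialDir_partialDir_eq_lineDeriv]
    refine lineDeriv_lineDeriv_eq_of_eqOn
      (M := fun q => (ζ h - algebraMap ℝ 𝔸 q.re) * qKer (ζ h) q) _
      (isOpen_update_preimage hVo x h) (fun q hq => ?_) hx'
      (fun q hq => hasDerivAt_qCoKer (isUnit_qDen_of_mem hV hq) v)
      (hasDerivAt_qCoKerFst (isUnit_qDen_of_mem hV hx') v)
    rw [hA _ hq, axProd_update, if_neg hK]
    rfl
  unfold lapl
  rw [h1, h1, h1, h1, ← map_add, ← map_add, ← map_add,
    sum_qCoKerSnd (isUnit_qDen_of_mem hV hx'),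
    partialDir_of_mem hVo hV hA hx (Finset.mem_insert_self h K), axRest_insert, ← map_smul]
  have h2 : (-2 : 𝔸) * (qNum (ζ h) 1 (x h) * qKer (ζ h) (x h) ^ 2) =
      (-2 : ℝ) • (qNum (ζ h) 1 (x h) * qKer (ζ h) (x h) ^ 2) := by
    rw [Algebra.smul_def, map_neg, map_ofNat]
  rw [h2]
  simp

/-- The kernels contain |Im x_h| only through its square, a polynomial in the real coordinates; this
gives smoothness across the real points, where `slicePart` itself is not differentiable. -/
theorem contDiffAt_of_representation [CompleteSpace 𝔸] (hVo : IsOpen V)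
    (hV : ∀ z ∈ V, ∀ h, IsUnit (axDen (ζ h) (z h).re ((z h).im ^ 2)))
    (hA : ∀ x, slicePart x ∈ V → ∀ K, A K x = L (axProd ζ K (slicePart x)))
    {x : Fin n → ℍ[ℝ]} (hx : slicePart x ∈ V) (K : Finset (Fin n)) :
    ContDiffAt ℝ (⊤ : ℕ∞) (A K) x := by
  have heq : A K =ᶠ[nhds x] fun x => L (axProd ζ K (slicePart x)) := by
    filter_upwards [(hVo.preimage continuous_slicePart).mem_nhds hx] with y hy using hA y hy K
  refine ContDiffAt.congr_of_eventuallyEq ?_ heq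
  refine L.contDiff.contDiffAt.comp x ?_
  have hcomp : ∀ (lam : ℍ[ℝ] →L[ℝ] ℝ) (h : Fin n),
      ContDiffAt ℝ (⊤ : ℕ∞) (fun x : Fin n → ℍ[ℝ] => lam (x h)) x := fun lam h =>
    (lam.contDiff.comp (contDiff_apply ℝ ℍ[ℝ] h)).contDiffAt
  have halg : ∀ f : (Fin n → ℍ[ℝ]) → ℝ, ContDiffAt ℝ (⊤ : ℕ∞) f x →
      ContDiffAt ℝ (⊤ : ℕ∞) (fun x => algebraMap ℝ 𝔸 (f x)) x := fun f hf =>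
    (algebraMapCLM ℝ 𝔸).contDiff.contDiffAt.comp x hf
  have hsub : ∀ h, ContDiffAt ℝ (⊤ : ℕ∞)
      (fun x : Fin n → ℍ[ℝ] => ζ h - algebraMap ℝ 𝔸 (x h).re) x := fun h =>
    contDiffAt_const.sub (halg _ (hcomp reL h))
  have hden : ∀ h, ContDiffAt ℝ (⊤ : ℕ∞) (fun x : Fin n → ℍ[ℝ] => qDen (ζ h) (x h)) x := by
    intro h
    unfold qDen axDen
    simp only [norm_im_sq]
    exact ((hsub h).pow 2).add (halg _ ((((hcomp imIL h).pow 2).add ((hcomp imJL h).pow 2)).add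
      ((hcomp imKL h).pow 2)))
  have hker : ∀ h, ContDiffAt ℝ (⊤ : ℕ∞) (fun x : Fin n → ℍ[ℝ] => qKer (ζ h) (x h)) x := by
    intro h
    obtain ⟨u, hu⟩ : IsUnit (qDen (ζ h) (x h)) := hV _ hx h
    have h1 := contDiffAt_ringInverse ℝ (n := (⊤ : ℕ∞)) u
    rw [hu] at h1
    exact h1.comp x (hden h)
  unfold axProd
  refine contDiffAt_prod fun h _ => ?_
  by_cases hh : h ∈ K
  · simp only [hh, if_true]
    exact hker h
  · simp only [hh, if_false]
    exact (hsub h).mul (hker h)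

end Representation

/-! ### The axial components of a holomorphic stem function -/

/-- Stem functions whose attached complex functions are continuous and separately holomorphic. -/
structure IsHoloStem (D : Set (Fin n → ℂ)) (G : (Fin n → ℂ) → StemVal n) : Prop where
  isStem : IsStem D G
  continuousOn : ∀ lam, ContinuousOn (stemPhi lam G) D
  differentiableAt : ∀ lam, ∀ z ∈ D, ∀ h : Fin n,
    DifferentiableAt ℂ (fun t => stemPhi lam G (Function.update z h t)) (z h)

/-- The continuous extension of `(∏_{h ∈ K} β_h)⁻¹ G_K` to the points with some `β_h = 0`. -/
def axComp (G : (Fin n → ℂ) → StemVal n) (K : Finset (Fin n)) : (Fin n → ℂ) → ℍ[ℝ] :=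
  extendFrom {z | ∀ h, (z h).im ≠ 0} fun z => (∏ h ∈ K, (z h).im)⁻¹ • G z K

/-- `axComp` as a function of quaternionic variables. -/
def axFun (G : (Fin n → ℂ) → StemVal n) (K : Finset (Fin n)) (x : Fin n → ℍ[ℝ]) : ℍ[ℝ] :=
  axComp G K (slicePart x)

lemma dense_im_ne_zero : Dense {z : Fin n → ℂ | ∀ h, (z h).im ≠ 0} := by
  have h1 : Dense {w : ℂ | w.im ≠ 0} :=
    (dense_compl_singleton (0 : ℝ)).preimage Complex.isOpenMap_im
  have h2 := dense_pi (Set.univ : Set (Fin n)) (s := fun _ => {w : ℂ | w.im ≠ 0}) fun _ _ => h1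
  convert h2 using 1
  ext z
  simp

lemma continuousAt_axProd {𝔸 : Type*} [NormedCommRing 𝔸] [NormedAlgebra ℝ 𝔸] [CompleteSpace 𝔸]
    {ζ : Fin n → 𝔸} {z : Fin n → ℂ}
    (hz : ∀ h, IsUnit (axDen (ζ h) (z h).re ((z h).im ^ 2))) (K : Finset (Fin n)) :
    ContinuousAt (axProd ζ K) z := by
  have hsub : ∀ h, Continuous fun z : Fin n → ℂ => ζ h - algebraMap ℝ 𝔸 (z h).re := fun h =>
    continuous_const.sub ((algebraMapCLM ℝ 𝔸).continuous.comp
      (Complex.continuous_re.comp (continuous_apply h)))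
  have hker : ∀ h, ContinuousAt
      (fun z : Fin n → ℂ => axKer (ζ h) (z h).re ((z h).im ^ 2)) z := by
    intro h
    obtain ⟨u, hu⟩ := hz h
    have h1 := (contDiffAt_ringInverse ℝ (n := 0) u).continuousAt
    have h2 : Continuous fun z : Fin n → ℂ => axDen (ζ h) (z h).re ((z h).im ^ 2) :=
      ((hsub h).pow 2).add ((algebraMapCLM ℝ 𝔸).continuous.comp
        ((Complex.continuous_im.comp (continuous_apply h)).pow 2))
    rw [hu] at h1
    exact ContinuousAt.comp (f := fun z : Fin n → ℂ => axDen (ζ h) (z h).re ((z h).im ^ 2))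
      h1 h2.continuousAt
  unfold axProd
  refine tendsto_finsetProd _ fun h _ => ?_
  by_cases hh : h ∈ K
  · simp only [hh, if_true]
    exact hker h
  · simp only [hh, if_false]
    exact (hsub h).continuousAt.mul (hker h)

/-- The right-hand side of the local formula is continuous and agrees with the quotient defining
`axComp` on a dense set. Thus `axComp` is one globally defined object, independent of the local
choice of r and L. -/
theorem IsHoloStem.exists_representation {D : Set (Fin n → ℂ)} {G : (Fin n → ℂ) → StemVal n}
    (hG : IsHoloStem D G) (hDo : IsOpen D) (hD : ConjInvariant D) {c : Fin n → ℂ} (hc : c ∈ D) :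
    ∃ (r : ℝ) (L : C(TorusSpace c, ℂ) →L[ℝ] ℍ[ℝ]), 0 < r ∧
      ∀ z ∈ Metric.ball c r,
      (∀ h, IsUnit (axDen (torusCoord c r h) (z h).re ((z h).im ^ 2))) ∧
      ∀ K, G z K = (∏ h ∈ K, (z h).im) • axComp G K z ∧
        axComp G K z = L (axProd (torusCoord c r) K z) := by
  obtain ⟨r, L, hr, hrD, hL⟩ :=
    exists_local_representation hDo hD hG.isStem hG.continuousOn hG.differentiableAt hc
  have key : ∀ z ∈ Metric.ball c r, ∀ K, axComp G K z = L (axProd (torusCoord c r) K z) := by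
    intro z hz K
    refine extendFrom_eq (dense_im_ne_zero z) ?_
    have h1 : ContinuousAt (fun z => L (axProd (torusCoord c r) K z)) z :=
      ContinuousAt.comp (f := axProd (torusCoord c r) K) (g := L) L.continuous.continuousAt
        (continuousAt_axProd (hL z hz).1 K)
    refine (h1.tendsto.mono_left nhdsWithin_le_nhds).congr' ?_
    filter_upwards [self_mem_nhdsWithin, mem_nhdsWithin_of_mem_nhds (Metric.isOpen_ball.mem_nhds hz)]
      with w hw hwb
    rw [(hL w hwb).2 K, smul_smul, inv_mul_cancel₀, one_smul]
    exact Finset.prod_ne_zero_iff.2 fun h _ => hw h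
  exact ⟨r, L, hr, fun z hz => ⟨(hL z hz).1, fun K => ⟨by rw [key z hz, (hL z hz).2], key z hz K⟩⟩⟩

section AxialComponents

variable {D : Set (Fin n → ℂ)} {G : (Fin n → ℂ) → StemVal n}

lemma IsHoloStem.eq_smul_axComp (hG : IsHoloStem D G) (hDo : IsOpen D) (hD : ConjInvariant D)
    {z : Fin n → ℂ} (hz : z ∈ D) (K : Finset (Fin n)) :
    G z K = (∏ h ∈ K, (z h).im) • axComp G K z := by
  obtain ⟨r, L, hr, h⟩ := hG.exists_representation hDo hD hz
  exact ((h z (Metric.mem_ball_self hr)).2 K).1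

lemma IsHoloStem.continuousAt_axComp (hG : IsHoloStem D G) (hDo : IsOpen D)
    (hD : ConjInvariant D) {z : Fin n → ℂ} (hz : z ∈ D) (K : Finset (Fin n)) :
    ContinuousAt (axComp G K) z := by
  obtain ⟨r, L, hr, h⟩ := hG.exists_representation hDo hD hz
  have h1 : ContinuousAt (fun w => L (axProd (torusCoord z r) K w)) z :=
    ContinuousAt.comp (f := axProd (torusCoord z r) K) (g := L) L.continuous.continuousAt
      (continuousAt_axProd (h z (Metric.mem_ball_self hr)).1 K)
  refine h1.congr ?_
  filter_upwards [Metric.ball_mem_nhds z hr] with w hw using ((h w hw).2 K).2.symm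

lemma IsHoloStem.contDiffAt_axFun (hG : IsHoloStem D G) (hDo : IsOpen D)
    (hD : ConjInvariant D) {x : Fin n → ℍ[ℝ]} (hx : slicePart x ∈ D) (K : Finset (Fin n)) :
    ContDiffAt ℝ (⊤ : ℕ∞) (axFun G K) x := by
  obtain ⟨r, L, hr, h⟩ := hG.exists_representation hDo hD hx
  exact contDiffAt_of_representation Metric.isOpen_ball (fun z hz => (h z hz).1)
    (fun x hx K => ((h _ hx).2 K).2) (Metric.mem_ball_self hr) K

lemma IsHoloStem.lapl_axFun_of_mem (hG : IsHoloStem D G) (hDo : IsOpen D)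
    (hD : ConjInvariant D) {x : Fin n → ℍ[ℝ]} (hx : slicePart x ∈ D) {h : Fin n}
    {K : Finset (Fin n)} (hK : h ∈ K) : lapl h (axFun G K) x = 0 := by
  obtain ⟨r, L, hr, hL⟩ := hG.exists_representation hDo hD hx
  exact lapl_of_mem (A := axFun G) Metric.isOpen_ball (fun z hz => (hL z hz).1)
    (fun x hx K => ((hL _ hx).2 K).2) (Metric.mem_ball_self hr) hK

lemma IsHoloStem.lapl_axFun_of_notMem (hG : IsHoloStem D G) (hDo : IsOpen D)
    (hD : ConjInvariant D) {x : Fin n → ℍ[ℝ]} (hx : slicePart x ∈ D) {h : Fin n}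
    {K : Finset (Fin n)} (hK : h ∉ K) :
    lapl h (axFun G K) x = (-2 : ℝ) • partialDir h 1 (axFun G (insert h K)) x := by
  obtain ⟨r, L, hr, hL⟩ := hG.exists_representation hDo hD hx
  exact lapl_of_notMem (A := axFun G) Metric.isOpen_ball (fun z hz => (hL z hz).1)
    (fun x hx K => ((hL _ hx).2 K).2) (Metric.mem_ball_self hr) hK

/-- A function of `(Re x_h, |Im x_h|)` only has an imaginary gradient proportional to `Im x_h`. -/
lemma IsHoloStem.exists_partialDir_eq (hG : IsHoloStem D G) (hDo : IsOpen D)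
    (hD : ConjInvariant D) (h : Fin n) {K : Finset (Fin n)} (hK : h ∈ K) :
    ∃ C : (Fin n → ℂ) → ℍ[ℝ], ∀ x, slicePart x ∈ D → ∀ v : ℍ[ℝ], v.re = 0 →
      partialDir h v (axFun G K) x = imDot (x h) v • C (slicePart x) := by
  choose! r L hr hL using fun c (hc : c ∈ D) => hG.exists_representation hDo hD hc
  -- The value at z uses the representation centred at z itself. No regularity of the resulting
  -- function of z is claimed.
  refine ⟨fun z => L z (axRest (torusCoord z (r z)) K h z *
    (-2 * axKer (torusCoord z (r z) h) (z h).re ((z h).im ^ 2) ^ 2)), fun x hx v hv => ?_⟩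
  rw [partialDir_of_mem (A := axFun G) Metric.isOpen_ball (fun z hz => (hL _ hx z hz).1)
    (fun y hy K => ((hL _ hx _ hy).2 K).2) (Metric.mem_ball_self (hr _ hx)) hK, ← map_smul]
  congr 1
  rw [Algebra.smul_def]
  have h1 : axKer (torusCoord (slicePart x) (r (slicePart x)) h) (slicePart x h).re
    ((slicePart x h).im ^ 2) = qKer (torusCoord (slicePart x) (r (slicePart x)) h) (x h) := rfl
  rw [h1]
  unfold qNum
  rw [hv, map_zero]
  ring

end AxialComponents

/-! ### Spherical derivatives in terms of the axial components -/

/-- The difference quotient at 0 is g itself, so continuity there is enough. -/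
lemma hasDerivAt_smul_of_continuousAt {E : Type*} [NormedAddCommGroup E] [NormedSpace ℝ E]
    {g : ℝ → E} (hg : ContinuousAt g 0) : HasDerivAt (fun t : ℝ => t • g t) (g 0) 0 := by
  rw [hasDerivAt_iff_tendsto_slope_zero]
  refine (hg.tendsto.mono_left nhdsWithin_le_nhds).congr' ?_
  filter_upwards [self_mem_nhdsWithin] with t ht
  have : t ≠ 0 := ht
  simp [smul_smul, this]

/-- Off β_h = 0 the quotient cancels the factor β_h; on β_h = 0 the derivative of β_h times a
continuous function has the same value. Both branches of the definition thus give one formula. -/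
lemma stemPrime_eq {D : Set (Fin n → ℂ)} (hDo : IsOpen D) {F : (Fin n → ℂ) → StemVal n}
    {B : Finset (Fin n) → (Fin n → ℂ) → ℍ[ℝ]}
    (hF : ∀ z ∈ D, ∀ K, F z K = (∏ h ∈ K, (z h).im) • B K z)
    (hB : ∀ z ∈ D, ∀ K, ContinuousAt (B K) z) (h : Fin n) {z : Fin n → ℂ} (hz : z ∈ D)
    (K : Finset (Fin n)) : stemPrime h F z K =
      (∏ h ∈ K, (z h).im) • (if h ∈ K then 0 else B (insert h K)) z := by
  unfold stemPrime
  by_cases hK : h ∈ K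
  · simp [hK]
  rw [if_neg hK, if_neg hK]
  by_cases h0 : (z h).im = 0
  · rw [if_pos h0]
    have hc : Continuous fun t : ℝ => z + t • (Pi.single h Complex.I : Fin n → ℂ) := by fun_prop
    have hc0 : z + (0 : ℝ) • (Pi.single h Complex.I : Fin n → ℂ) = z := by simp
    have hg : ContinuousAt (fun t : ℝ => (∏ j ∈ K, (z j).im) •
        B (insert h K) (z + t • (Pi.single h Complex.I : Fin n → ℂ))) 0 := by
      have hgB : ContinuousAt (fun t : ℝ =>
          B (insert h K) (z + t • (Pi.single h Complex.I : Fin n → ℂ))) 0 := by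
        refine ContinuousAt.comp (g := B (insert h K)) ?_ hc.continuousAt
        rw [hc0]
        exact hB z hz _
      exact hgB.const_smul (∏ j ∈ K, (z j).im)
    have h1 := hasDerivAt_smul_of_continuousAt hg
    have h2 : (fun t : ℝ => F (z + t • (Pi.single h Complex.I : Fin n → ℂ)) (insert h K))
        =ᶠ[nhds 0] fun t : ℝ => t • (∏ j ∈ K, (z j).im) •
          B (insert h K) (z + t • (Pi.single h Complex.I : Fin n → ℂ)) := by
      have hc' := hc.tendsto 0
      rw [hc0] at hc'
      filter_upwards [hc' (hDo.mem_nhds hz)] with t ht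
      rw [hF _ ht, Finset.prod_insert hK, mul_smul]
      congr 1
      · simp [h0]
      · congr 1
        refine Finset.prod_congr rfl fun j hj => ?_
        have : j ≠ h := fun e => hK (e ▸ hj)
        simp [this]
    have h3 := (h1.congr_of_eventuallyEq h2).deriv
    rw [hc0] at h3
    exact h3
  · rw [if_neg h0, hF z hz, Finset.prod_insert hK, mul_smul, smul_smul, inv_mul_cancel₀ h0,
      one_smul]

/-- The form (∏ β_h) B_K is preserved by each step with a new continuous family B, hence the
induction generalises over B. A repeated index would give zero, which is why the list has no
duplicates. -/
lemma foldl_stemPrime_eq {D : Set (Fin n → ℂ)} (hDo : IsOpen D) (l : List (Fin n))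
    (hl : l.Nodup) {F : (Fin n → ℂ) → StemVal n} {B : Finset (Fin n) → (Fin n → ℂ) → ℍ[ℝ]}
    (hF : ∀ z ∈ D, ∀ K, F z K = (∏ h ∈ K, (z h).im) • B K z)
    (hB : ∀ z ∈ D, ∀ K, ContinuousAt (B K) z) {z : Fin n → ℂ} (hz : z ∈ D)
    (K : Finset (Fin n)) : l.foldl (fun G h => stemPrime h G) F z K =
      if Disjoint K l.toFinset then (∏ h ∈ K, (z h).im) • B (K ∪ l.toFinset) z else 0 := by
  induction l generalizing F B with
  | nil => simpa using hF z hz K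
  | cons a l ih =>
    rw [List.nodup_cons] at hl
    rw [List.foldl_cons]
    rw [ih hl.2 (B := fun K => if a ∈ K then 0 else B (insert a K))
      (fun z hz K => stemPrime_eq hDo hF hB a hz K) (fun z hz K => ?_)]
    · simp only [List.toFinset_cons, Finset.disjoint_insert_right, Finset.mem_union,
        List.mem_toFinset, hl.1, or_false, Finset.union_insert]
      by_cases h1 : Disjoint K l.toFinset <;> by_cases h2 : a ∈ K <;> simp [h1, h2]
    · by_cases h2 : a ∈ K
      · simp only [h2, if_true]
        exact continuousAt_const
      · simp only [h2, if_false]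
        exact hB z hz _

lemma IsHoloStem.stemPrimes_eq {D : Set (Fin n → ℂ)} {G : (Fin n → ℂ) → StemVal n}
    (hG : IsHoloStem D G) (hDo : IsOpen D) (hD : ConjInvariant D) (H : Finset (Fin n))
    {z : Fin n → ℂ} (hz : z ∈ D) (K : Finset (Fin n)) : stemPrimes H G z K =
      if Disjoint K H then (∏ h ∈ K, (z h).im) • axComp G (K ∪ H) z else 0 := by
  have h1 := foldl_stemPrime_eq hDo (H.sort (· ≤ ·)) (H.sort_nodup _)
    (fun z hz K => hG.eq_smul_axComp hDo hD hz K)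
    (fun z hz K => hG.continuousAt_axComp hDo hD hz K) hz K
  rw [Finset.sort_toFinset] at h1
  exact h1

/-! ### The circularization -/

lemma slicePart_slicePoint {z : Fin n → ℂ} {J : Fin n → ℍ[ℝ]} (hJ : ∀ h, J h ∈ imagUnits) :
    slicePart (slicePoint z J) =
      conjOn (Finset.univ.filter fun h => (z h).im < 0) z := by
  have him : ∀ h, (slicePoint z J h).im = (z h).im • J h := by
    intro h
    have := (imagUnits_spec (hJ h)).1
    ext <;> simp [slicePoint, this, mul_comm]
  have hre : ∀ h, (slicePoint z J h).re = (z h).re := by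
    intro h
    simp [slicePoint, (imagUnits_spec (hJ h)).1]
  funext h
  unfold slicePart conjOn
  rw [hre, him, norm_smul, (imagUnits_spec (hJ h)).2, mul_one, Real.norm_eq_abs]
  by_cases hh : (z h).im < 0
  · apply Complex.ext <;> simp [hh, abs_of_neg hh]
  · apply Complex.ext <;> simp [hh, abs_of_nonneg (not_lt.1 hh)]

lemma im_slicePoint {z : Fin n → ℂ} {J : Fin n → ℍ[ℝ]} (hJ : ∀ h, J h ∈ imagUnits) (h : Fin n) :
    (slicePoint z J h).im = (z h).im • J h := by
  have := (imagUnits_spec (hJ h)).1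
  ext <;> simp [slicePoint, this, mul_comm]

lemma qi_mem_imagUnits : qi ∈ imagUnits := by
  change qi * qi = -1
  ext <;> simp

lemma im_mul_im_self (q : ℍ[ℝ]) : q.im * q.im = ((-‖q.im‖ ^ 2 : ℝ) : ℍ[ℝ]) := by
  rw [← pow_two, Quaternion.im_sq, Quaternion.normSq_eq_norm_mul_self, Quaternion.coe_neg,
    pow_two]

/-- Conjugation invariance allows every β_h to be taken nonnegative, so Ω_D is the preimage of D
under a continuous map. -/
lemma mem_circ_iff {D : Set (Fin n → ℂ)} (hD : ConjInvariant D) {x : Fin n → ℍ[ℝ]} :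
    x ∈ circ D ↔ slicePart x ∈ D := by
  constructor
  · rintro ⟨z, hz, J, hJ, rfl⟩
    rw [slicePart_slicePoint hJ]
    exact IsStem.conjOn_mem hD hz _
  · intro hx
    classical
    -- At a real coordinate any imaginary unit serves; `qi` is taken.
    refine ⟨slicePart x, hx, fun h => if (x h).im = 0 then qi else ‖(x h).im‖⁻¹ • (x h).im,
      fun h => ?_, funext fun h => ?_⟩
    · by_cases h0 : (x h).im = 0
      · simp only [h0, if_true]
        exact qi_mem_imagUnits
      · simp only [h0, if_false]
        change (‖(x h).im‖⁻¹ • (x h).im) * (‖(x h).im‖⁻¹ • (x h).im) = -1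
        have h1 : ‖(x h).im‖ ≠ 0 := norm_ne_zero_iff.2 h0
        rw [smul_mul_smul_comm, im_mul_im_self, Quaternion.smul_coe]
        field_simp
        simp
    · unfold slicePoint slicePart
      by_cases h0 : (x h).im = 0
      · simp only [h0, if_true, norm_zero]
        conv_lhs => rw [← Quaternion.re_add_im (x h), h0]
        simp
      · simp only [h0, if_false]
        have h1 : ‖(x h).im‖ ≠ 0 := norm_ne_zero_iff.2 h0
        rw [smul_mul_assoc, Quaternion.mul_coe_eq_smul, smul_smul, inv_mul_cancel₀ h1, one_smul,
          Quaternion.re_add_im]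

lemma isOpen_circ {D : Set (Fin n → ℂ)} (hDo : IsOpen D) (hD : ConjInvariant D) :
    IsOpen (circ D) := by
  have h1 : circ D = slicePart ⁻¹' D := Set.ext fun x => mem_circ_iff hD
  rw [h1]
  exact hDo.preimage continuous_slicePart

/-- The ordered product of the imaginary parts of the `x_h`, `h ∈ K`. -/
def imProd (K : Finset (Fin n)) (x : Fin n → ℍ[ℝ]) : ℍ[ℝ] := ordProd (fun h => (x h).im) K

/-- The factors β_h left over combine with the imaginary units into the imaginary parts Im x_h,
which are smooth, unlike the units themselves. -/
lemma IsHoloStem.induced_stemPrimes_eq {D : Set (Fin n → ℂ)} {G : (Fin n → ℂ) → StemVal n}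
    (hG : IsHoloStem D G) (hDo : IsOpen D) (hD : ConjInvariant D) (H : Finset (Fin n))
    {x : Fin n → ℍ[ℝ]} (hx : x ∈ circ D) : induced (stemPrimes H G) x =
      ∑ K ∈ Finset.univ.filter (fun K => Disjoint K H), imProd K x * axFun G (K ∪ H) x := by
  unfold induced
  rw [Finset.sum_filter]
  refine Finset.sum_congr rfl fun K _ => ?_
  rw [hG.stemPrimes_eq hDo hD H ((mem_circ_iff hD).1 hx)]
  split_ifs
  · have h1 : (fun h => (x h).im) = fun h => (slicePart x h).im • sliceUnit x h := by
      funext h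
      unfold slicePart sliceUnit
      by_cases h0 : (x h).im = 0
      · simp [h0]
      · simp [smul_smul, norm_ne_zero_iff.2 h0]
    unfold imProd axFun
    rw [h1, ordProd_smul, mul_smul_comm, smul_mul_assoc]
  · simp

/-! ### Partial derivatives in quaternionic variables -/

lemma hasDerivAt_partialDir {f : (Fin n → ℍ[ℝ]) → ℍ[ℝ]} {x : Fin n → ℍ[ℝ]}
    (hf : DifferentiableAt ℝ f x) (h : Fin n) (v : ℍ[ℝ]) :
    HasDerivAt (fun t : ℝ => f (x + t • (Pi.single h v : Fin n → ℍ[ℝ]))) (partialDir h v f x) 0 :=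
  (hf.lineDifferentiableAt (v := (Pi.single h v : Fin n → ℍ[ℝ]))).hasLineDerivAt

lemma partialDir_eq_fderiv {f : (Fin n → ℍ[ℝ]) → ℍ[ℝ]} {x : Fin n → ℍ[ℝ]}
    (hf : DifferentiableAt ℝ f x) (h : Fin n) (v : ℍ[ℝ]) :
    partialDir h v f x = fderiv ℝ f x (Pi.single h v) :=
  hf.lineDeriv_eq_fderiv

lemma partialDir_congr {f g : (Fin n → ℍ[ℝ]) → ℍ[ℝ]} {U : Set (Fin n → ℍ[ℝ])} (hU : IsOpen U)
    (hfg : Set.EqOn f g U) (h : Fin n) (v : ℍ[ℝ]) :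
    Set.EqOn (partialDir h v f) (partialDir h v g) U := fun _ hx =>
  (hfg.eventuallyEq_of_mem (hU.mem_nhds hx)).lineDeriv_eq

lemma crf_congr {f g : (Fin n → ℍ[ℝ]) → ℍ[ℝ]} {U : Set (Fin n → ℍ[ℝ])} (hU : IsOpen U)
    (hfg : Set.EqOn f g U) (h : Fin n) : Set.EqOn (crf h f) (crf h g) U := by
  intro x hx
  unfold crf
  simp only [partialDir_congr hU hfg h _ hx]

lemma crfBar_congr {f g : (Fin n → ℍ[ℝ]) → ℍ[ℝ]} {U : Set (Fin n → ℍ[ℝ])} (hU : IsOpen U)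
    (hfg : Set.EqOn f g U) (h : Fin n) : Set.EqOn (crfBar h f) (crfBar h g) U := by
  intro x hx
  unfold crfBar
  simp only [partialDir_congr hU hfg h _ hx]

lemma lapl_congr {f g : (Fin n → ℍ[ℝ]) → ℍ[ℝ]} {U : Set (Fin n → ℍ[ℝ])} (hU : IsOpen U)
    (hfg : Set.EqOn f g U) (h : Fin n) : Set.EqOn (lapl h f) (lapl h g) U := by
  intro x hx
  unfold lapl
  simp only [partialDir_congr hU (partialDir_congr hU hfg h _) h _ hx]

lemma eventuallyEq_partialDir {f : (Fin n → ℍ[ℝ]) → ℍ[ℝ]} {x : Fin n → ℍ[ℝ]}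
    (hf : ContDiffAt ℝ (⊤ : ℕ∞) f x) (h : Fin n) (v : ℍ[ℝ]) :
    partialDir h v f =ᶠ[nhds x] fun y => fderiv ℝ f y (Pi.single h v) := by
  have h1 : ContDiffAt ℝ 1 f x := hf.of_le (by exact_mod_cast le_top)
  filter_upwards [h1.eventually (by simp)] with y hy
  exact partialDir_eq_fderiv (hy.differentiableAt one_ne_zero) h v

lemma contDiffAt_partialDir {f : (Fin n → ℍ[ℝ]) → ℍ[ℝ]} {x : Fin n → ℍ[ℝ]}
    (hf : ContDiffAt ℝ (⊤ : ℕ∞) f x) (h : Fin n) (v : ℍ[ℝ]) :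
    ContDiffAt ℝ (⊤ : ℕ∞) (partialDir h v f) x := by
  refine ContDiffAt.congr_of_eventuallyEq ?_ (eventuallyEq_partialDir hf h v)
  exact (hf.fderiv_right (m := (⊤ : ℕ∞)) (by simp)).clm_apply contDiffAt_const

lemma differentiableAt_of_contDiffAt_top {f : (Fin n → ℍ[ℝ]) → ℍ[ℝ]} {x : Fin n → ℍ[ℝ]}
    (hf : ContDiffAt ℝ (⊤ : ℕ∞) f x) : DifferentiableAt ℝ f x :=
  hf.differentiableAt (by simp)

lemma two_le_coe_top : (2 : WithTop ℕ∞) ≤ ((⊤ : ℕ∞) : WithTop ℕ∞) :=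
  WithTop.coe_le_coe.2 (le_top (a := (2 : ℕ∞)))

lemma partialDir_comm {f : (Fin n → ℍ[ℝ]) → ℍ[ℝ]} {x : Fin n → ℍ[ℝ]}
    (hf : ContDiffAt ℝ (⊤ : ℕ∞) f x) (h : Fin n) (v w : ℍ[ℝ]) :
    partialDir h v (partialDir h w f) x = partialDir h w (partialDir h v f) x := by
  have hd : DifferentiableAt ℝ (fderiv ℝ f) x :=
    (hf.fderiv_right (m := (⊤ : ℕ∞)) (by simp)).differentiableAt (by simp)
  have h1 : ∀ v w : ℍ[ℝ], partialDir h v (partialDir h w f) x =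
      fderiv ℝ (fderiv ℝ f) x (Pi.single h v) (Pi.single h w) := by
    intro v w
    rw [partialDir_eq_fderiv (differentiableAt_of_contDiffAt_top (contDiffAt_partialDir hf h w)),
      (eventuallyEq_partialDir hf h w).fderiv_eq]
    rw [fderiv_clm_apply hd (differentiableAt_const _)]
    simp
  rw [h1, h1]
  exact (hf.isSymmSndFDerivAt (by simpa using two_le_coe_top)).eq _ _

lemma partialDir_crf {f : (Fin n → ℍ[ℝ]) → ℍ[ℝ]} {x : Fin n → ℍ[ℝ]}
    (hf : ContDiffAt ℝ (⊤ : ℕ∞) f x) (h : Fin n) (v : ℍ[ℝ]) :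
    partialDir h v (crf h f) x = (1 / 2 : ℝ) • (partialDir h v (partialDir h 1 f) x
      - qi * partialDir h v (partialDir h qi f) x - qj * partialDir h v (partialDir h qj f) x
      - qk * partialDir h v (partialDir h qk f) x) := by
  have h1 : ∀ w, HasDerivAt
      (fun t : ℝ => partialDir h w f (x + t • (Pi.single h v : Fin n → ℍ[ℝ])))
      (partialDir h v (partialDir h w f) x) 0 := fun w =>
    hasDerivAt_partialDir (differentiableAt_of_contDiffAt_top (contDiffAt_partialDir hf h w)) h v
  exact (((((h1 1).sub ((h1 qi).const_mul qi)).sub ((h1 qj).const_mul qj)).sub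
    ((h1 qk).const_mul qk)).const_smul (1 / 2 : ℝ)).deriv

/-- Mixed second derivatives commute while i, j, k anticommute, so the cross terms cancel. -/
lemma crfBar_crf {f : (Fin n → ℍ[ℝ]) → ℍ[ℝ]} {x : Fin n → ℍ[ℝ]}
    (hf : ContDiffAt ℝ (⊤ : ℕ∞) f x) (h : Fin n) :
    crfBar h (crf h f) x = (1 / 4 : ℝ) • lapl h f x := by
  unfold crfBar lapl
  simp only [partialDir_crf hf]
  rw [partialDir_comm hf h qi 1, partialDir_comm hf h qj 1, partialDir_comm hf h qk 1,
    partialDir_comm hf h qj qi, partialDir_comm hf h qk qi, partialDir_comm hf h qk qj]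
  generalize partialDir h 1 (partialDir h 1 f) x = a
  generalize partialDir h 1 (partialDir h qi f) x = b
  generalize partialDir h 1 (partialDir h qj f) x = c
  generalize partialDir h 1 (partialDir h qk f) x = d
  generalize partialDir h qi (partialDir h qi f) x = e
  generalize partialDir h qi (partialDir h qj f) x = p
  generalize partialDir h qi (partialDir h qk f) x = q
  generalize partialDir h qj (partialDir h qj f) x = r
  generalize partialDir h qj (partialDir h qk f) x = s
  generalize partialDir h qk (partialDir h qk f) x = u
  ext <;> simp <;> ring

lemma contDiffAt_crf {f : (Fin n → ℍ[ℝ]) → ℍ[ℝ]} {x : Fin n → ℍ[ℝ]}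
    (hf : ContDiffAt ℝ (⊤ : ℕ∞) f x) (h : Fin n) : ContDiffAt ℝ (⊤ : ℕ∞) (crf h f) x := by
  have h1 := fun w => contDiffAt_partialDir hf h w
  exact ((((h1 1).sub (contDiffAt_const.mul (h1 qi))).sub (contDiffAt_const.mul (h1 qj))).sub
    (contDiffAt_const.mul (h1 qk))).const_smul (1 / 2 : ℝ)

/-! ### Products of imaginary parts -/

lemma imProd_add_smul_single {K : Finset (Fin n)} {h : Fin n} (hK : h ∉ K)
    (x : Fin n → ℍ[ℝ]) (v : ℍ[ℝ]) (t : ℝ) :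
    imProd K (x + t • (Pi.single h v : Fin n → ℍ[ℝ])) = imProd K x := by
  unfold imProd ordProd
  congr 1
  refine List.map_congr_left fun k hk => ?_
  have : k ≠ h := fun e => hK (e ▸ (Finset.mem_sort _).1 hk)
  simp [this]

lemma imProd_insert {K : Finset (Fin n)} {h : Fin n} (hK : ∀ k ∈ K, h < k)
    (x : Fin n → ℍ[ℝ]) : imProd (insert h K) x = (x h).im * imProd K x := by
  have hh : h ∉ K := fun e => lt_irrefl _ (hK h e)
  unfold imProd ordProd
  rw [Finset.sort_insert (· ≤ ·) (fun k hk => (hK k hk).le) hh, List.map_cons, List.prod_cons]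

lemma contDiff_im_apply (h : Fin n) :
    ContDiff ℝ (⊤ : ℕ∞) fun x : Fin n → ℍ[ℝ] => (x h).im := by
  have h1 : (fun x : Fin n → ℍ[ℝ] => (x h).im) = fun x => x h - reL (x h) • (1 : ℍ[ℝ]) := by
    funext x
    ext <;> simp
  rw [h1]
  have h2 : ContDiff ℝ (⊤ : ℕ∞) fun x : Fin n → ℍ[ℝ] => x h := contDiff_apply ℝ ℍ[ℝ] h
  exact h2.sub ((reL.contDiff.comp h2).smul contDiff_const)

lemma contDiff_imProd (K : Finset (Fin n)) : ContDiff ℝ (⊤ : ℕ∞) (imProd K) := by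
  unfold imProd ordProd
  induction K.sort (· ≤ ·) with
  | nil => exact contDiff_const
  | cons a l ih =>
    simp only [List.map_cons, List.prod_cons]
    exact (contDiff_im_apply a).mul ih

lemma partialDir_sum_imProd_mul {P : Finset (Finset (Fin n))} {h : Fin n}
    (hP : ∀ K ∈ P, h ∉ K) {g : Finset (Fin n) → (Fin n → ℍ[ℝ]) → ℍ[ℝ]} {x : Fin n → ℍ[ℝ]}
    (hg : ∀ K, ContDiffAt ℝ (⊤ : ℕ∞) (g K) x) (v : ℍ[ℝ]) :
    partialDir h v (fun x => ∑ K ∈ P, imProd K x * g K x) x =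
      ∑ K ∈ P, imProd K x * partialDir h v (g K) x := by
  have h1 : HasDerivAt (fun t : ℝ => ∑ K ∈ P, imProd K x *
      g K (x + t • (Pi.single h v : Fin n → ℍ[ℝ])))
      (∑ K ∈ P, imProd K x * partialDir h v (g K) x) 0 :=
    HasDerivAt.fun_sum fun K _ => (hasDerivAt_partialDir
      (differentiableAt_of_contDiffAt_top (hg K)) h v).const_mul (imProd K x)
  refine (hasDerivAt_of_eq h1 (fun t => ?_) rfl).deriv
  exact Finset.sum_congr rfl fun K hK => by rw [imProd_add_smul_single (hP K hK)]

lemma lapl_sum_imProd_mul {P : Finset (Finset (Fin n))} {h : Fin n}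
    (hP : ∀ K ∈ P, h ∉ K) {g : Finset (Fin n) → (Fin n → ℍ[ℝ]) → ℍ[ℝ]}
    {U : Set (Fin n → ℍ[ℝ])} (hU : IsOpen U)
    (hg : ∀ K, ∀ x ∈ U, ContDiffAt ℝ (⊤ : ℕ∞) (g K) x) {x : Fin n → ℍ[ℝ]} (hx : x ∈ U) :
    lapl h (fun x => ∑ K ∈ P, imProd K x * g K x) x = ∑ K ∈ P, imProd K x * lapl h (g K) x := by
  have h1 : ∀ v, partialDir h v (partialDir h v fun x => ∑ K ∈ P, imProd K x * g K x) x =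
      ∑ K ∈ P, imProd K x * partialDir h v (partialDir h v (g K)) x := by
    intro v
    rw [partialDir_congr hU (fun y hy => partialDir_sum_imProd_mul hP (fun K => hg K y hy) v) h v
      hx]
    exact partialDir_sum_imProd_mul hP (fun K => contDiffAt_partialDir (hg K x hx) h v) v
  unfold lapl
  simp only [h1, mul_add, Finset.sum_add_distrib]

lemma hasDerivAt_im_line (x : Fin n → ℍ[ℝ]) (h : Fin n) (v : ℍ[ℝ]) :
    HasDerivAt (fun t : ℝ => ((x + t • (Pi.single h v : Fin n → ℍ[ℝ])) h).im) v.im 0 := by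
  have h1 := ((hasDerivAt_id (0 : ℝ)).smul_const v.im).const_add (x h).im
  refine hasDerivAt_of_eq h1 (fun t => ?_) (by simp)
  simp

lemma partialDir_im_mul {g : (Fin n → ℍ[ℝ]) → ℍ[ℝ]} {x : Fin n → ℍ[ℝ]}
    (hg : ContDiffAt ℝ (⊤ : ℕ∞) g x) (h : Fin n) (v : ℍ[ℝ]) :
    partialDir h v (fun x => (x h).im * g x) x = v.im * g x + (x h).im * partialDir h v g x := by
  have h1 := (hasDerivAt_im_line x h v).mul
    (hasDerivAt_partialDir (differentiableAt_of_contDiffAt_top hg) h v)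
  refine (hasDerivAt_of_eq h1 (fun t => rfl) ?_).deriv
  simp

/-- Leibniz rule for the linear factor Im x_h, whose derivative along v is Im v; only the cross
terms along i, j, k remain. -/
lemma lapl_im_mul {g : (Fin n → ℍ[ℝ]) → ℍ[ℝ]} {U : Set (Fin n → ℍ[ℝ])} (hU : IsOpen U)
    (hg : ∀ x ∈ U, ContDiffAt ℝ (⊤ : ℕ∞) g x) {x : Fin n → ℍ[ℝ]} (hx : x ∈ U) (h : Fin n) :
    lapl h (fun x => (x h).im * g x) x = (x h).im * lapl h g x + (2 : ℝ) •
      (qi * partialDir h qi g x + qj * partialDir h qj g x + qk * partialDir h qk g x) := by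
  have h1 : ∀ v, partialDir h v (partialDir h v fun x => (x h).im * g x) x =
      (x h).im * partialDir h v (partialDir h v g) x + (2 : ℝ) • (v.im * partialDir h v g x) := by
    intro v
    rw [partialDir_congr hU (fun y hy => partialDir_im_mul (hg y hy) h v) h v hx]
    have h2 := hasDerivAt_partialDir (differentiableAt_of_contDiffAt_top (hg x hx)) h v
    have h3 := hasDerivAt_partialDir (differentiableAt_of_contDiffAt_top
      (contDiffAt_partialDir (hg x hx) h v)) h v
    have h4 := (h2.const_mul v.im).add ((hasDerivAt_im_line x h v).mul h3)
    refine (hasDerivAt_of_eq h4 (fun t => rfl) ?_).deriv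
    simp only [zero_smul, add_zero, two_smul]
    abel
  have hi : qi.im = qi := by ext <;> simp
  have hj : qj.im = qj := by ext <;> simp
  have hk : qk.im = qk := by ext <;> simp
  have h0 : (1 : ℍ[ℝ]).im = 0 := by ext <;> simp
  unfold lapl
  rw [h1, h1, h1, h1, hi, hj, hk, h0]
  simp only [mul_add, smul_add, zero_mul, smul_zero]
  abel

/-! ### Slice functions -/

lemma IsSlice.congr {D : Set (Fin n → ℂ)} {f g : (Fin n → ℍ[ℝ]) → ℍ[ℝ]} (hf : IsSlice D f)
    (hfg : Set.EqOn g f (circ D)) : IsSlice D g := by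
  obtain ⟨F, hF, hFf⟩ := hf
  exact ⟨F, hF, fun z hz J hJ => (hfg ⟨z, hz, J, hJ, rfl⟩).trans (hFf z hz J hJ)⟩

lemma IsSlice.add {D : Set (Fin n → ℂ)} {f g : (Fin n → ℍ[ℝ]) → ℍ[ℝ]} (hf : IsSlice D f)
    (hg : IsSlice D g) : IsSlice D (fun x => f x + g x) := by
  obtain ⟨F, hF, hFf⟩ := hf
  obtain ⟨G, hG, hGg⟩ := hg
  refine ⟨fun z K => F z K + G z K, fun z hz h K => ?_, fun z hz J hJ => ?_⟩
  · change F _ K + G _ K = _ • (F z K + G z K)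
    rw [hF z hz, hG z hz, smul_add]
  · change f _ + g _ = ∑ K, ordProd J K * (F z K + G z K)
    rw [hFf z hz J hJ, hGg z hz J hJ, ← Finset.sum_add_distrib]
    simp only [mul_add]

lemma IsSlice.const_smul {D : Set (Fin n → ℂ)} {f : (Fin n → ℍ[ℝ]) → ℍ[ℝ]} (hf : IsSlice D f)
    (c : ℝ) : IsSlice D (fun x => c • f x) := by
  obtain ⟨F, hF, hFf⟩ := hf
  refine ⟨fun z K => c • F z K, fun z hz h K => ?_, fun z hz J hJ => ?_⟩
  · change c • F _ K = _ • (c • F z K)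
    rw [hF z hz, smul_comm]
  · change c • f _ = ∑ K, ordProd J K * (c • F z K)
    rw [hFf z hz J hJ, Finset.smul_sum]
    simp only [mul_smul_comm]

lemma isSlice_zero (D : Set (Fin n → ℂ)) : IsSlice D (fun _ => 0) :=
  ⟨0, fun _ _ _ _ => by simp, fun _ _ _ _ => by simp⟩

lemma IsSlice.sum {ι : Type*} {D : Set (Fin n → ℂ)} {f : ι → (Fin n → ℍ[ℝ]) → ℍ[ℝ]}
    (s : Finset ι) (hf : ∀ i ∈ s, IsSlice D (f i)) : IsSlice D (fun x => ∑ i ∈ s, f i x) := by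
  classical
  induction s using Finset.induction_on with
  | empty => simpa using isSlice_zero D
  | insert a s ha ih =>
    simp only [Finset.sum_insert ha]
    exact (hf a (Finset.mem_insert_self a s)).add
      (ih fun i hi => hf i (Finset.mem_insert_of_mem hi))

/-- The inducing stem function is supported on K and equals β_K times E evaluated at (α, |β|). The
second factor is even in each β_h for an arbitrary E, so no regularity of E enters. -/
lemma isSlice_imProd_mul (D : Set (Fin n → ℂ)) (K : Finset (Fin n)) (E : (Fin n → ℂ) → ℍ[ℝ]) :
    IsSlice D (fun x => imProd K x * E (slicePart x)) := by
  let ab : (Fin n → ℂ) → (Fin n → ℂ) := fun z =>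
    conjOn (Finset.univ.filter fun h => (z h).im < 0) z
  have hab : ∀ z h, ab z h = ⟨(z h).re, |(z h).im|⟩ := by
    intro z h
    by_cases hh : (z h).im < 0
    · apply Complex.ext <;> simp [ab, conjOn, hh, abs_of_neg hh]
    · apply Complex.ext <;> simp [ab, conjOn, hh, abs_of_nonneg (not_lt.1 hh)]
  refine ⟨fun z L => if L = K then (∏ h ∈ L, (z h).im) • E (ab z) else 0,
    fun z hz h L => ?_, fun z hz J hJ => ?_⟩
  · by_cases hL : L = K
    · simp only [hL, if_true]
      have h1 : ab (conjAt h z) = ab z := by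
        funext k
        rw [hab, hab]
        by_cases hk : k = h
        · subst hk; simp [conjAt]
        · simp [conjAt, Function.update_of_ne hk]
      have h2 : ∏ k ∈ K, (conjAt h z k).im =
          (-1 : ℝ) ^ (K ∩ {h}).card * ∏ k ∈ K, (z k).im := by
        by_cases hK : h ∈ K
        · rw [Finset.inter_singleton_of_mem hK, ← Finset.mul_prod_erase _ _ hK,
            ← Finset.mul_prod_erase K (fun k => (z k).im) hK]
          have h3 : ∏ k ∈ K.erase h, (conjAt h z k).im = ∏ k ∈ K.erase h, (z k).im :=
            Finset.prod_congr rfl fun k hk => by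
              simp [conjAt, Function.update_of_ne (Finset.ne_of_mem_erase hk)]
          rw [h3]
          simp [conjAt]
        · rw [Finset.inter_singleton_of_notMem hK]
          simp only [Finset.card_empty, pow_zero, one_mul]
          refine Finset.prod_congr rfl fun k hk => ?_
          have : k ≠ h := fun e => hK (e ▸ hk)
          simp [conjAt, Function.update_of_ne this]
      rw [h1, h2, mul_smul]
    · simp [hL]
  · have h1 : imProd K (slicePoint z J) = (∏ h ∈ K, (z h).im) • ordProd J K := by
      unfold imProd
      simp only [im_slicePoint hJ]
      exact ordProd_smul _ _ _
    rw [Finset.sum_eq_single K (fun L _ hL => by simp [hL]) (by simp)]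
    simp only [if_true]
    rw [h1, slicePart_slicePoint hJ, smul_mul_assoc, mul_smul_comm]

lemma IsAxiallyMonogenic.congr {D : Set (Fin n → ℂ)} (hDo : IsOpen D) (hD : ConjInvariant D)
    {h : Fin n} {f g : (Fin n → ℍ[ℝ]) → ℍ[ℝ]} (hf : IsAxiallyMonogenic D h f)
    (hfg : Set.EqOn g f (circ D)) : IsAxiallyMonogenic D h g :=
  ⟨hf.1.congr hfg, hf.2.1.congr hfg, fun x hx =>
    (crfBar_congr (isOpen_circ hDo hD) hfg h hx).trans (hf.2.2 x hx)⟩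

lemma IsAxiallyMonogenic.const_smul {D : Set (Fin n → ℂ)} {h : Fin n}
    {f : (Fin n → ℍ[ℝ]) → ℍ[ℝ]} (hf : IsAxiallyMonogenic D h f) (c : ℝ) :
    IsAxiallyMonogenic D h (fun x => c • f x) := by
  refine ⟨hf.1.const_smul c, hf.2.1.const_smul c, fun x hx => ?_⟩
  have h1 : ∀ v, partialDir h v (fun x => c • f x) x = c • partialDir h v f x := fun v =>
    deriv_const_smul_field c _
  have h2 := hf.2.2 x hx
  unfold crfBar at h2 ⊢
  simp only [h1, mul_smul_comm, ← smul_add]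
  rw [smul_comm, h2, smul_zero]

/-! ### The ordered components of the Almansi decomposition -/

/-- The function `∑_K Im(x)_K A_{K ∪ H}`, where `K` is disjoint from `H` and `A` are the axial
components of `G`; on `Ω_D` it is the `H`-th spherical derivative of `ℐ(G)`. -/
def axSum (G : (Fin n → ℂ) → StemVal n) (H : Finset (Fin n)) (x : Fin n → ℍ[ℝ]) : ℍ[ℝ] :=
  ∑ K ∈ Finset.univ.filter (fun K => Disjoint K H), imProd K x * axFun G (K ∪ H) x

section

variable {D : Set (Fin n → ℂ)} {G : (Fin n → ℂ) → StemVal n}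

lemma IsHoloStem.contDiffAt_axSum (hG : IsHoloStem D G) (hDo : IsOpen D)
    (hD : ConjInvariant D) (H : Finset (Fin n)) {x : Fin n → ℍ[ℝ]} (hx : x ∈ circ D) :
    ContDiffAt ℝ (⊤ : ℕ∞) (axSum G H) x :=
  ContDiffAt.sum fun K _ => (contDiff_imProd K).contDiffAt.mul
    (hG.contDiffAt_axFun hDo hD ((mem_circ_iff hD).1 hx) (K ∪ H))

/-- A real displacement leaves the imaginary parts unchanged, so this derivative is again a function
of `slicePart x`, as `isSlice_imProd_mul` requires. -/
lemma partialDir_one_axFun (G : (Fin n → ℂ) → StemVal n) (K : Finset (Fin n)) (h : Fin n)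
    (x : Fin n → ℍ[ℝ]) : partialDir h 1 (axFun G K) x =
      lineDeriv ℝ (axComp G K) (slicePart x) (Pi.single h 1) := by
  unfold partialDir lineDeriv axFun
  congr 1
  funext t
  congr 1
  funext k
  by_cases hk : k = h
  · subst hk; apply Complex.ext <;> simp [slicePart]
  · apply Complex.ext <;> simp [slicePart, hk]

lemma notMem_of_mem_filter_disjoint {H : Finset (Fin n)} {h : Fin n} (hh : h ∈ H) :
    ∀ K ∈ Finset.univ.filter (fun K => Disjoint K H), h ∉ K := by
  intro K hK hhK
  exact Finset.disjoint_left.1 (Finset.mem_filter.1 hK).2 hhK hh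

lemma IsHoloStem.lapl_axSum_of_mem (hG : IsHoloStem D G) (hDo : IsOpen D)
    (hD : ConjInvariant D) {H : Finset (Fin n)} {h : Fin n} (hh : h ∈ H) {x : Fin n → ℍ[ℝ]}
    (hx : x ∈ circ D) : lapl h (axSum G H) x = 0 := by
  unfold axSum
  rw [lapl_sum_imProd_mul (notMem_of_mem_filter_disjoint hh) (isOpen_circ hDo hD)
    (g := fun K => axFun G (K ∪ H))
    (fun K y hy => hG.contDiffAt_axFun hDo hD ((mem_circ_iff hD).1 hy) _) hx]
  refine Finset.sum_eq_zero fun K _ => ?_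
  rw [hG.lapl_axFun_of_mem hDo hD ((mem_circ_iff hD).1 hx) (Finset.mem_union_right K hh), mul_zero]

/-- The coefficients `imDot x v` are real, so they move past p and reassemble the units on its left
into Im x. -/
lemma half_smul_crf_term (p c d x : ℍ[ℝ]) :
    (1 / 2 : ℝ) • (p * d - qi * (p * (imDot x qi • c)) - qj * (p * (imDot x qj • c))
      - qk * (p * (imDot x qk • c))) =
    p * ((1 / 2 : ℝ) • d) + (x.im * p) * ((-1 / 2 : ℝ) • c) := by
  have h2 : x.im = imDot x qi • qi + imDot x qj • qj + imDot x qk • qk := by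
    ext <;> simp [imDot]
  rw [h2]
  simp only [mul_smul_comm, smul_mul_assoc, add_mul, mul_assoc]
  module

/-- Each term yields a multiple of Im(x)_K and one of Im(x_h) Im(x)_K. Since h precedes all indices
outside H, the latter product is correctly ordered and equals the one for `insert h K`; without this
order it need not have slice form. -/
lemma IsHoloStem.isSlice_crf_axSum (hG : IsHoloStem D G) (hDo : IsOpen D)
    (hD : ConjInvariant D) {H : Finset (Fin n)} {h : Fin n} (hh : h ∈ H)
    (hlt : ∀ k ∉ H, h < k) : IsSlice D (crf h (axSum G H)) := by
  choose C hC using fun K : Finset (Fin n) =>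
    hG.exists_partialDir_eq hDo hD h (Finset.mem_union_right K hh)
  let E : Finset (Fin n) → (Fin n → ℂ) → ℍ[ℝ] := fun K z =>
    (1 / 2 : ℝ) • lineDeriv ℝ (axComp G (K ∪ H)) z (Pi.single h 1)
  let E' : Finset (Fin n) → (Fin n → ℂ) → ℍ[ℝ] := fun K z => (-1 / 2 : ℝ) • C K z
  have hslice : IsSlice D (fun x => ∑ K ∈ Finset.univ.filter (fun K => Disjoint K H),
      (imProd K x * E K (slicePart x) + imProd (insert h K) x * E' K (slicePart x))) :=
    IsSlice.sum _ fun K _ =>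
      (isSlice_imProd_mul D K (E K)).add (isSlice_imProd_mul D (insert h K) (E' K))
  refine hslice.congr fun x hx => ?_
  have hx' := (mem_circ_iff hD).1 hx
  have h1 : ∀ v, partialDir h v (axSum G H) x =
      ∑ K ∈ Finset.univ.filter (fun K => Disjoint K H),
        imProd K x * partialDir h v (axFun G (K ∪ H)) x := fun v =>
    partialDir_sum_imProd_mul (notMem_of_mem_filter_disjoint hh)
      (g := fun K => axFun G (K ∪ H)) (fun K => hG.contDiffAt_axFun hDo hD hx' _) v
  unfold crf
  simp only [h1, Finset.mul_sum, ← Finset.sum_sub_distrib, Finset.smul_sum]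
  refine Finset.sum_congr rfl fun K hK => ?_
  rw [hC K x hx' qi rfl, hC K x hx' qj rfl, hC K x hx' qk rfl, partialDir_one_axFun,
    imProd_insert fun k hk => hlt k fun hkH =>
      Finset.disjoint_left.1 (Finset.mem_filter.1 hK).2 hk hkH]
  exact half_smul_crf_term _ _ _ _

theorem IsHoloStem.isAxiallyMonogenic_crf_axSum (hG : IsHoloStem D G) (hDo : IsOpen D)
    (hD : ConjInvariant D) {H : Finset (Fin n)} {h : Fin n} (hh : h ∈ H)
    (hlt : ∀ k ∉ H, h < k) : IsAxiallyMonogenic D h (crf h (axSum G H)) := by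
  refine ⟨hG.isSlice_crf_axSum hDo hD hh hlt, fun x hx => ?_, fun x hx => ?_⟩
  · exact ((contDiffAt_crf (hG.contDiffAt_axSum hDo hD H hx) h).of_le
      (by exact_mod_cast le_top)).contDiffWithinAt
  · rw [crfBar_crf (hG.contDiffAt_axSum hDo hD H hx), hG.lapl_axSum_of_mem hDo hD hh hx, smul_zero]

/-- Among the indices outside H the smallest is h, so in every term containing it Im x_h is the
leftmost factor and can be pulled out of the sum. -/
lemma axSum_eq {H : Finset (Fin n)} {h : Fin n} (hh : h ∉ H)
    (hlt : ∀ k ∉ insert h H, h < k) (x : Fin n → ℍ[ℝ]) :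
    axSum G H x = ∑ K ∈ Finset.univ.filter (fun K => Disjoint K (insert h H)),
      imProd K x * axFun G (K ∪ H) x + (x h).im * axSum G (insert h H) x := by
  unfold axSum
  rw [← Finset.sum_filter_add_sum_filter_not _ (fun K => h ∉ K)]
  congr 1
  · rw [Finset.filter_filter]
    refine Finset.sum_congr (Finset.filter_congr fun K _ => ?_) fun _ _ => rfl
    rw [Finset.disjoint_insert_right]
    tauto
  · rw [Finset.mul_sum, Finset.filter_filter]
    refine (Finset.sum_bij (fun K _ => insert h K) ?_ ?_ ?_ ?_).symm
    · intro K hK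
      have h1 := (Finset.mem_filter.1 hK).2
      rw [Finset.disjoint_insert_right] at h1
      simp [Finset.disjoint_insert_left, hh, h1.2]
    · intro K hK L hL hKL
      have h1 := notMem_of_mem_filter_disjoint (Finset.mem_insert_self h H) K hK
      have h2 := notMem_of_mem_filter_disjoint (Finset.mem_insert_self h H) L hL
      rw [← Finset.erase_insert h1, hKL, Finset.erase_insert h2]
    · intro K hK
      obtain ⟨h1, h2⟩ := (Finset.mem_filter.1 hK).2
      rw [not_not] at h2
      refine ⟨K.erase h, ?_, Finset.insert_erase h2⟩
      simp only [Finset.mem_filter, Finset.mem_univ, true_and, Finset.disjoint_insert_right,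
        Finset.notMem_erase, not_false_eq_true]
      exact h1.mono_left (Finset.erase_subset h K)
    · intro K hK
      rw [imProd_insert fun k hk => hlt k fun hkH =>
        Finset.disjoint_left.1 (Finset.mem_filter.1 hK).2 hk hkH, mul_assoc, Finset.union_insert,
        Finset.insert_union]

/-- In the splitting Q + Im(x_h) R, the part Q contributes -2 times the real derivative of R. As R
is harmonic in x_h, the other part contributes twice the sum of v ∂_v R over v = i, j, k. Together
these are -4 ∂_{x_h} R. -/
theorem IsHoloStem.lapl_axSum_eq (hG : IsHoloStem D G) (hDo : IsOpen D)
    (hD : ConjInvariant D) {H : Finset (Fin n)} {h : Fin n} (hh : h ∉ H)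
    (hlt : ∀ k ∉ insert h H, h < k) {x : Fin n → ℍ[ℝ]} (hx : x ∈ circ D) :
    lapl h (axSum G H) x = (-4 : ℝ) • crf h (axSum G (insert h H)) x := by
  have hU := isOpen_circ hDo hD
  have hx' := (mem_circ_iff hD).1 hx
  set Q : (Fin n → ℍ[ℝ]) → ℍ[ℝ] := fun x =>
    ∑ K ∈ Finset.univ.filter (fun K => Disjoint K (insert h H)), imProd K x * axFun G (K ∪ H) x
    with hQ
  set R := axSum G (insert h H) with hR
  have hQs : ∀ y ∈ circ D, ContDiffAt ℝ (⊤ : ℕ∞) Q y := fun y hy =>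
    ContDiffAt.sum fun K _ => (contDiff_imProd K).contDiffAt.mul
      (hG.contDiffAt_axFun hDo hD ((mem_circ_iff hD).1 hy) (K ∪ H))
  have hRs : ∀ y ∈ circ D, ContDiffAt ℝ (⊤ : ℕ∞) R y := fun y hy =>
    hG.contDiffAt_axSum hDo hD _ hy
  have hTs : ∀ y ∈ circ D, ContDiffAt ℝ (⊤ : ℕ∞) (fun x => (x h).im * R x) y := fun y hy =>
    (contDiff_im_apply h).contDiffAt.mul (hRs y hy)
  have hS : axSum G H = fun x => Q x + (x h).im * R x := funext fun x => axSum_eq hh hlt x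
  have hadd : ∀ {f g : (Fin n → ℍ[ℝ]) → ℍ[ℝ]} {y}, ContDiffAt ℝ (⊤ : ℕ∞) f y →
      ContDiffAt ℝ (⊤ : ℕ∞) g y → ∀ v,
      partialDir h v (fun x => f x + g x) y = partialDir h v f y + partialDir h v g y :=
    fun hf hg v =>
      ((hasDerivAt_partialDir (differentiableAt_of_contDiffAt_top hf) h v).add
        (hasDerivAt_partialDir (differentiableAt_of_contDiffAt_top hg) h v)).deriv
  have hlapl : lapl h (axSum G H) x = lapl h Q x + lapl h (fun x => (x h).im * R x) x := by
    have h1 : ∀ v, partialDir h v (partialDir h v (axSum G H)) x =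
        partialDir h v (partialDir h v Q) x +
          partialDir h v (partialDir h v fun x => (x h).im * R x) x := by
      intro v
      rw [hS, partialDir_congr hU (fun y hy => hadd (hQs y hy) (hTs y hy) v) h v hx]
      exact hadd (contDiffAt_partialDir (hQs x hx) h v) (contDiffAt_partialDir (hTs x hx) h v) v
    unfold lapl
    simp only [h1]
    abel
  have hlQ : lapl h Q x = (-2 : ℝ) • partialDir h 1 R x := by
    have hn := notMem_of_mem_filter_disjoint (Finset.mem_insert_self h H)
    rw [hQ, lapl_sum_imProd_mul hn hU (g := fun K => axFun G (K ∪ H))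
      (fun K y hy => hG.contDiffAt_axFun hDo hD ((mem_circ_iff hD).1 hy) _) hx]
    have h2 : partialDir h 1 R x = _ := partialDir_sum_imProd_mul hn
      (g := fun K => axFun G (K ∪ insert h H)) (fun K => hG.contDiffAt_axFun hDo hD hx' _) 1
    rw [h2, Finset.smul_sum]
    refine Finset.sum_congr rfl fun K hK => ?_
    have h3 : h ∉ K ∪ H := by
      rw [Finset.mem_union, not_or]
      exact ⟨hn K hK, hh⟩
    rw [hG.lapl_axFun_of_notMem hDo hD hx' h3, Finset.union_insert, mul_smul_comm]
  rw [hlapl, hlQ, lapl_im_mul hU hRs hx,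
    hG.lapl_axSum_of_mem hDo hD (Finset.mem_insert_self h H) hx, mul_zero, zero_add]
  unfold crf
  module

end

/-! ### Holomorphy of Z_K ⊗ F and the proof of the proposition -/

lemma IsHolo.isHoloStem_stemMul {D : Set (Fin n → ℂ)} (hDo : IsOpen D)
    {F F' : (Fin n → ℂ) → StemVal n} (hF : IsStem D F) (hF' : IsHolo D F')
    (hFF' : ∀ z ∈ D, F z = F' z) (K : Finset (Fin n)) :
    IsHoloStem D (stemMul (stemMonomial K) F) := by
  have hphi : ∀ lam, ∀ z ∈ D, stemPhi lam (stemMul (stemMonomial K) F) z =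
      ((K.sort (· ≤ ·)).map z).prod * stemPhi lam F' z := by
    intro lam z hz
    rw [stemPhi_stemMonomial_stemMul]
    unfold stemPhi
    rw [hFF' z hz]
  have hprod : Continuous fun z : Fin n → ℂ => ((K.sort (· ≤ ·)).map z).prod :=
    continuous_list_prod _ fun i _ => continuous_apply i
  refine ⟨(isStem_stemMonomial D K).stemMul hF, fun lam => ?_, fun lam z hz h => ?_⟩
  · exact (hprod.continuousOn.mul (continuousOn_stemPhi hF'.1 lam)).congr (hphi lam)
  · have h1 : (fun t => stemPhi lam (stemMul (stemMonomial K) F) (Function.update z h t))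
        =ᶠ[nhds (z h)] fun t => ((K.sort (· ≤ ·)).map (Function.update z h t)).prod *
          stemPhi lam F' (Function.update z h t) := by
      have hc : Continuous fun t => Function.update z h t := continuous_const.update h continuous_id
      have hc' := hc.tendsto (z h)
      rw [Function.update_eq_self] at hc'
      filter_upwards [hc' (hDo.mem_nhds hz)] with t ht using hphi lam _ ht
    refine DifferentiableAt.congr_of_eventuallyEq ?_ h1
    refine DifferentiableAt.mul ?_ (hF'.differentiableAt_stemPhi hDo lam hz h)
    have h2 : ∀ l : List (Fin n), DifferentiableAt ℂ
        (fun t => (l.map (Function.update z h t)).prod) (z h) := by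
      intro l
      induction l with
      | nil => exact differentiableAt_const _
      | cons a l ih =>
        simp only [List.map_cons, List.prod_cons]
        refine DifferentiableAt.mul ?_ ih
        by_cases ha : a = h
        · subst ha; simp
        · simp [Function.update_of_ne ha]
    exact h2 _

end SeveralSlice

end
open SeveralSlice in
theorem proposition4p4 (n : ℕ) (D : Set (Fin n → ℂ)) (hDopen : IsOpen D)
    (hDconj : ConjInvariant D) (f : (Fin n → ℍ[ℝ]) → ℍ[ℝ]) (hf : IsSliceRegular D f)
    (m : ℕ) (hm : 1 ≤ m) (hmn : m < n) (K : Finset (Fin n)) (hK : K ⊆ firstVars n m) :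
    ContDiffOn ℝ 2 (ordAlmansi D m K f) (circ D) ∧
    IsAxiallyMonogenic D ⟨m - 1, by omega⟩ (crf ⟨m - 1, by omega⟩ (ordAlmansi D m K f)) ∧
    IsAxiallyMonogenic D ⟨m, hmn⟩ (lapl ⟨m, hmn⟩ (ordAlmansi D m K f)) := by
  obtain ⟨F', hF's, hF'h, hF'i⟩ := hf
  have hslice : IsSlice D f := ⟨F', hF's, hF'i⟩
  have hspec : IsStem D (inducingStem D f) ∧ Induces D (inducingStem D f) f := by
    unfold inducingStem
    rw [dif_pos hslice]
    exact hslice.choose_spec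
  have hG : IsHoloStem D (stemMul (stemMonomial K) (inducingStem D f)) :=
    IsHolo.isHoloStem_stemMul hDopen hspec.1 hF'h
      (fun z hz => Induces.unique hspec.2 hF'i hz) K
  have hU := isOpen_circ hDopen hDconj
  have heq : Set.EqOn (ordAlmansi D m K f)
      (axSum (stemMul (stemMonomial K) (inducingStem D f)) (firstVars n m)) (circ D) :=
    fun x hx => hG.induced_stemPrimes_eq hDopen hDconj (firstVars n m) hx
  refine ⟨?_, ?_, ?_⟩
  · refine ContDiffOn.congr (fun x hx => ?_) heq
    exact ((hG.contDiffAt_axSum hDopen hDconj _ hx).of_le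
      two_le_coe_top).contDiffWithinAt
  -- The variable x_m has index m - 1, the largest in `firstVars n m`, so every index outside that
  -- set exceeds it.
  · refine (hG.isAxiallyMonogenic_crf_axSum hDopen hDconj (H := firstVars n m) ?_ ?_).congr
      hDopen hDconj (crf_congr hU heq _)
    · simp [firstVars]
      omega
    · intro k hk
      simp only [firstVars, Finset.mem_filter, Finset.mem_univ, true_and] at hk
      rw [Fin.lt_def]
      change m - 1 < k
      omega
  · have hlt : ∀ k ∉ insert ⟨m, hmn⟩ (firstVars n m), (⟨m, hmn⟩ : Fin n) < k := by
      intro k hk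
      simp only [firstVars, Finset.mem_insert, Finset.mem_filter, Finset.mem_univ, true_and,
        not_or, Fin.ext_iff] at hk
      rw [Fin.lt_def]
      change m < k
      omega
    -- The Laplacian in x_{m+1} is -4 times the function that part 1 treats when the index m is
    -- added to the first m variables.
    refine ((hG.isAxiallyMonogenic_crf_axSum hDopen hDconj (Finset.mem_insert_self ⟨m, hmn⟩ _)
      hlt).const_smul (-4)).congr hDopen hDconj fun x hx => ?_
    rw [lapl_congr hU heq _ hx]
    exact hG.lapl_axSum_eq hDopen hDconj (by simp [firstVars]) hlt hx
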